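/- **Setting.** Let $d\ge 2$ and let $\Omega\subset\mathbb R^d$ be a bounded domain with smooth boundary. For a measurable set $S\subseteq\Omega$ let $L^\infty_+(S)$ denote the functions in $L^\infty(S)$ with positive essential infimum. For coefficients $\sigma\in L^\infty_+(\Omega)$ and $q\in L^\infty(\Omega)$, $q\ge 0$, and for $g\in L^2(\partial\Omega)$, a function $u\in H^1(\Omega)$ is called the solution with Neumann data $g$ and coefficients $(\sigma,q)$ if $$\int_\Omega \sigma\nabla u\cdot\nabla w\,dx+\int_\Omega q\,u\,w\,dx=\int_{\partial\Omega} g\,w\,ds\qquad\text{for all } w\in H^1(\Omega),$$ which is the weak form of $-\nabla\cdot(\sigma\nabla u)+qu=0$ in $\Omega$, $\sigma\partial_\nu u=g$ on $\partial\Omega$. The Neumann-to-Dirichlet operator $\Lambda(\sigma,q):L^2(\partial\Omega)\to L^2(\partial\Omega)$ maps $g$ to the trace $u|_{\partial\Omega}$ of this solution, and $\langle\cdot,\cdot\rangle$ is the inner product of $L^2(\partial\Omega)$. **(a)** Let $\sigma_1,\sigma_2,q_1,q_2\in L^\infty_+(\Omega)$ and $g\in L^2(\partial\Omega)$, and let $u_1,u_2\in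 H^1(\Omega)$ be the solutions with Neumann data $g$ and coefficients $(\sigma_1,q_1)$ and $(\sigma_2,q_2)$, respectively. Then $$\int_\Omega\bigl[(\sigma_2-\sigma_1)|\nabla u_1|^2+(q_2-q_1)u_1^2\bigr]dx\ \ge\ \langle g,(\Lambda(\sigma_1,q_1)-\Lambda(\sigma_2,q_2))g\rangle\ \ge\ \int_\Omega\bigl[(\sigma_2-\sigma_1)|\nabla u_2|^2+(q_2-q_1)u_2^2\bigr]dx$$ and $$\langle g,(\Lambda(\sigma_1,q_1)-\Lambda(\sigma_2,q_2))g\rangle\ \ge\ \int_\Omega\Bigl[\Bigl(\sigma_1-\frac{\sigma_1^2}{\sigma_2}\Bigr)|\nabla u_1|^2+\Bigl(q_1-\frac{q_1^2}{q_2}\Bigr)u_1^2\Bigr]dx=\int_\Omega\Bigl[\frac{\sigma_1}{\sigma_2}(\sigma_2-\sigma_1)|\nabla u_1|^2+\frac{q_1}{q_2}(q_2-q_1)u_1^2\Bigr]dx.$$ **(b)** Let $\omega$ be a nonempty open set with $\overline\omega\subset\Omega$, let $\sigma_0,\sigma_1>0$ be constants, and put $\sigma=\sigma_0\chi_{\Omega\setminus\omega}+\sigma_1\chi_\omega$.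 For $q\in L^\infty_+(\omega)$, extended by zero to $\Omega$, write $\Lambda(q)=\Lambda(\sigma,q)$. Let $q_1,q_2\in L^\infty_+(\omega)$ and $g\in L^2(\partial\Omega)$, and let $u_2\in H^1(\Omega)$ be the solution with Neumann data $g$ and coefficients $(\sigma,q_2)$. Then $$\int_\omega(q_1-q_2)u_2^2\,dx\ \ge\ \int_{\partial\Omega}g\,(\Lambda(q_2)-\Lambda(q_1))g\,ds\ \ge\ \int_\omega\Bigl(q_2-\frac{q_2^2}{q_1}\Bigr)u_2^2\,dx.$$ **(c)** In the setting of (b), if $q_1\le q_2$ almost everywhere in $\omega$, then $\Lambda(q_1)\ge\Lambda(q_2)$ in the sense of quadratic forms, that is, $\langle g,\Lambda(q_1)g\rangle\ge\langle g,\Lambda(q_2)g\rangle$ for all $g\in L^2(\partial\Omega)$. -/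

import Mathlib

open MeasureTheory Set Filter Topology
open scoped ENNReal ContDiff

noncomputable section

namespace NeumannProblem

/-- The Euclidean space of dimension `d = n + 1`. -/
abbrev E (n : ℕ) : Type := EuclideanSpace ℝ (Fin (n + 1))

/-- The first `n` coordinates of a point of `E n`. -/
def firstCoords {n : ℕ} (x : E n) : EuclideanSpace ℝ (Fin n) :=
  WithLp.toLp 2 (fun i : Fin n => x i.castSucc)

/-- `Ω` has a smooth boundary: near each boundary point and after a rigid change of coordinates
`R`, the boundary is the graph of a `C^∞` function `γ` of the first `n` coordinates, and `Ω` is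
the part above the graph. -/
def HasSmoothBoundary {n : ℕ} (Ω : Set (E n)) : Prop :=
  ∀ z ∈ frontier Ω, ∃ ε : ℝ, 0 < ε ∧ ∃ (R : E n ≃ₗᵢ[ℝ] E n) (γ : EuclideanSpace ℝ (Fin n) → ℝ),
    ContDiff ℝ ∞ γ ∧
    (∀ x ∈ Metric.ball z ε, (x ∈ frontier Ω ↔ R x (Fin.last n) = γ (firstCoords (R x)))) ∧
    (∀ x ∈ Metric.ball z ε, (x ∈ Ω ↔ γ (firstCoords (R x)) < R x (Fin.last n)))

/-- A bounded domain (nonempty, open, connected) with smooth boundary. -/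
structure IsSmoothBoundedDomain {n : ℕ} (Ω : Set (E n)) : Prop where
  isOpen : IsOpen Ω
  isConnected : IsConnected Ω
  isBounded : Bornology.IsBounded Ω
  smoothBoundary : HasSmoothBoundary Ω

/-- `f ∈ L^∞_+(S)`: essentially bounded on `S`, with positive essential infimum. -/
def LinftyPlus {n : ℕ} (S : Set (E n)) (f : E n → ℝ) : Prop :=
  MemLp f ∞ (volume.restrict S) ∧ ∃ c : ℝ, 0 < c ∧ ∀ᵐ x ∂(volume.restrict S), c ≤ f x

/-- The surface measure on `∂Ω`: the `n`-dimensional Hausdorff measure of `ℝ^(n+1)`, normalized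
so that it is Lebesgue measure on `n`-dimensional subspaces, restricted to `∂Ω`. -/
def surfaceMeasure {n : ℕ} (Ω : Set (E n)) : Measure (E n) :=
  (Measure.euclideanHausdorffMeasure n : Measure (E n)).restrict (frontier Ω)

/-- The real Hilbert space `L²(∂Ω)`. -/
abbrev L2Boundary {n : ℕ} (Ω : Set (E n)) : Type := Lp ℝ 2 (surfaceMeasure Ω)

/-- `φ k → u` in `H¹(Ω)`, where `Du` is the gradient of `u`. -/
def TendstoH1 {n : ℕ} (Ω : Set (E n)) (φ : ℕ → E n → ℝ) (u : E n → ℝ) (Du : E n → E n) : Prop :=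
  Tendsto (fun k => eLpNorm (fun x => φ k x - u x) 2 (volume.restrict Ω)) atTop (𝓝 0) ∧
  Tendsto (fun k => eLpNorm (fun x => gradient (φ k) x - Du x) 2 (volume.restrict Ω)) atTop (𝓝 0)

/-- `u ∈ H¹(Ω)` with gradient `Du`. The space `H¹(Ω)` is the completion, for the norm
`(‖u‖²_{L²(Ω)} + ‖∇u‖²_{L²(Ω)})^(1/2)`, of the functions that are smooth up to the boundary,
i.e. of the restrictions to `Ω` of functions in `C^∞(ℝ^(n+1))`. On a bounded domain with smooth
boundary this is the space of the `u ∈ L²(Ω)` with weak gradient `Du ∈ L²(Ω)`. -/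
def IsH1 {n : ℕ} (Ω : Set (E n)) (u : E n → ℝ) (Du : E n → E n) : Prop :=
  MemLp u 2 (volume.restrict Ω) ∧ MemLp Du 2 (volume.restrict Ω) ∧
  ∃ φ : ℕ → E n → ℝ, (∀ k, ContDiff ℝ ∞ (φ k)) ∧ TendstoH1 Ω φ u Du

/-- `f ∈ L²(∂Ω)` is the trace `u|_∂Ω` of `u ∈ H¹(Ω)` (with gradient `Du`). The trace operator is
the continuous extension to `H¹(Ω)` of the restriction `φ ↦ φ|_∂Ω` of smooth functions: `u` is a
limit in `H¹(Ω)` of smooth functions whose boundary values tend to `f` in `L²(∂Ω)`. -/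
def HasTrace {n : ℕ} (Ω : Set (E n)) (u : E n → ℝ) (Du : E n → E n) (f : L2Boundary Ω) : Prop :=
  MemLp u 2 (volume.restrict Ω) ∧ MemLp Du 2 (volume.restrict Ω) ∧
  ∃ φ : ℕ → E n → ℝ, (∀ k, ContDiff ℝ ∞ (φ k)) ∧ TendstoH1 Ω φ u Du ∧
    Tendsto (fun k => eLpNorm (fun x => φ k x - f x) 2 (surfaceMeasure Ω)) atTop (𝓝 0)

/-- `u ∈ H¹(Ω)`, with gradient `Du`, is a weak solution of `-∇·(σ∇u) + qu = 0` in `Ω`,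
`σ ∂_ν u = g` on `∂Ω`. -/
def IsWeakSolution {n : ℕ} (Ω : Set (E n)) (σ q : E n → ℝ) (g : L2Boundary Ω)
    (u : E n → ℝ) (Du : E n → E n) : Prop :=
  IsH1 Ω u Du ∧
  ∀ (w : E n → ℝ) (Dw : E n → E n), IsH1 Ω w Dw → ∀ h : L2Boundary Ω, HasTrace Ω w Dw h →
    (∫ x in Ω, σ x * inner ℝ (Du x) (Dw x)) + (∫ x in Ω, q x * (u x * w x))
      = ∫ x, g x * h x ∂(surfaceMeasure Ω)

open Classical in
/-- The Neumann-to-Dirichlet operator `Λ(σ,q) : L²(∂Ω) → L²(∂Ω)`, `g ↦ u|_∂Ω`, where `u` is the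
weak solution with Neumann data `g`. -/
def NtD {n : ℕ} (Ω : Set (E n)) (σ q : E n → ℝ) (g : L2Boundary Ω) : L2Boundary Ω :=
  if h : ∃ f : L2Boundary Ω, ∃ (u : E n → ℝ) (Du : E n → E n),
      IsWeakSolution Ω σ q g u Du ∧ HasTrace Ω u Du f
  then h.choose else 0

/-- The diffusion coefficient `σ₀ χ_{Ω∖D} + σ₁ χ_D`. -/
def twoPhase {n : ℕ} (Ω D : Set (E n)) (s₀ s₁ : ℝ) : E n → ℝ :=
  fun x => (Ω \ D).indicator (fun _ => s₀) x + D.indicator (fun _ => s₁) x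

/-- The operator `Λ(q)` for an absorption coefficient `q` on `D`, extended by zero to `Ω`, and
the diffusion coefficient `σ₀ χ_{Ω∖D} + σ₁ χ_D`. -/
def NtDAbs {n : ℕ} (Ω D : Set (E n)) (s₀ s₁ : ℝ) (q : E n → ℝ) (g : L2Boundary Ω) :
    L2Boundary Ω :=
  NtD Ω (twoPhase Ω D s₀ s₁) (D.indicator q) g

end NeumannProblem

end

open NeumannProblem

namespace NeumannProblem

/-! ### Estimates along segments -/

/-! Write `b_i` for the energy form with coefficients `(σ_i, q_i)`. Testing each equation with `u_1`
or `u_2` gives `⟨g, Λ_1 g⟩ = b_1(u_1,u_1)` and `⟨g, Λ_2 g⟩ = b_1(u_1,u_2) = b_2(u_2,u_2)`, so the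
difference of the quadratic forms is `b_1(u_1,u_1) - 2 b_1(u_1,u_2) + b_2(u_2,u_2)`
(`inner_NtD_sub_eq`). Everything else in the comparison is pointwise completion of squares:
splitting off `b_1(u_1-u_2, u_1-u_2) ≥ 0` leaves the lower bound in `u_2`, exchanging the indices
gives the upper bound in `u_1`, and completing the square in `u_2` with weights `σ_2`, `q_2` gives
the bound with quotients.

The analysis serves to make these identities available. `NtD` is defined by choice with default
value `0`, so a solution and its trace must exist; its quadratic form is then independent of the
choice by symmetry of the energy form (`inner_NtD_eq`), without any uniqueness theorem. Traces come
from the trace inequality `traceControlled_univ`. Existence is needed for the two-phase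
coefficients, where only one of the two solutions is given, or neither. It follows from Lax-Milgram
(`exists_isWeakSolution`), applied in the closure of the triples (function, gradient, boundary
values). Since the absorption vanishes outside `D`, coercivity requires the Poincaré inequality
`l2Controlled_univ`, which bounds the `L²` norm on `Ω` by the gradient on `Ω` and the `L²` norm on
`D`.

Both inequalities come from the fundamental theorem of calculus along segments. Control on `D`
spreads through the connected set `Ω` by small translations and reaches the boundary by pushing
inward along the vertical direction of a graph chart; the trace bound averages over such inward
segments. -/

theorem sq_lintegral_le {α : Type*} [MeasurableSpace α] {μ : Measure α} {h : α → ℝ≥0∞}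
    (hh : AEMeasurable h μ) : (∫⁻ x, h x ∂μ) ^ 2 ≤ μ univ * ∫⁻ x, h x ^ 2 ∂μ := by
  have key := ENNReal.lintegral_mul_le_Lp_mul_Lq μ Real.HolderConjugate.two_two
    (f := fun _ => 1) (g := h) aemeasurable_const hh
  simp only [Pi.mul_apply, one_mul, ENNReal.one_rpow, lintegral_const] at key
  calc (∫⁻ x, h x ∂μ) ^ 2
      ≤ (μ univ ^ (1 / 2 : ℝ) * (∫⁻ x, h x ^ (2 : ℝ) ∂μ) ^ (1 / 2 : ℝ)) ^ 2 := by gcongr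
    _ = μ univ * ∫⁻ x, h x ^ 2 ∂μ := by
      rw [mul_pow, ← ENNReal.rpow_natCast, ← ENNReal.rpow_natCast, ← ENNReal.rpow_mul,
        ← ENNReal.rpow_mul]
      norm_num

theorem enorm_sub_sq_le_lintegral_deriv {f : ℝ → ℝ} (hf : ContDiff ℝ 1 f) {a b : ℝ}
    (hab : a ≤ b) :
    ‖f b - f a‖ₑ ^ 2 ≤ ENNReal.ofReal (b - a) * ∫⁻ t in Ioc a b, ‖deriv f t‖ₑ ^ 2 := by
  have hd : Continuous (deriv f) := hf.continuous_deriv le_rfl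
  have h1 : f b - f a = ∫ t in Ioc a b, deriv f t := by
    rw [← intervalIntegral.integral_of_le hab, intervalIntegral.integral_deriv_eq_sub]
    · exact fun x _ => (hf.differentiable one_ne_zero) x
    · exact hd.intervalIntegrable _ _
  calc ‖f b - f a‖ₑ ^ 2 ≤ (∫⁻ t in Ioc a b, ‖deriv f t‖ₑ) ^ 2 := by
        rw [h1]; gcongr; exact enorm_integral_le_lintegral_enorm _
    _ ≤ _ := by
        refine (sq_lintegral_le hd.enorm.measurable.aemeasurable).trans ?_
        simp

theorem enorm_sq_le_two_mul (a b : ℝ) : ‖a‖ₑ ^ 2 ≤ 2 * ‖b‖ₑ ^ 2 + 2 * ‖b - a‖ₑ ^ 2 := by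
  simp only [← ofReal_norm, Real.norm_eq_abs]
  rw [← ENNReal.ofReal_pow (abs_nonneg _), ← ENNReal.ofReal_pow (abs_nonneg _),
    ← ENNReal.ofReal_pow (abs_nonneg _), show (2 : ℝ≥0∞) = ENNReal.ofReal 2 by simp,
    ← ENNReal.ofReal_mul (by norm_num), ← ENNReal.ofReal_mul (by norm_num),
    ← ENNReal.ofReal_add (by positivity) (by positivity)]
  apply ENNReal.ofReal_le_ofReal
  simp only [sq_abs]
  -- Right side minus left side is exactly `(a - 2b)²`.
  nlinarith [sq_nonneg (a - 2 * b)]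

section Segments

variable {V : Type*} [NormedAddCommGroup V] [InnerProductSpace ℝ V] [CompleteSpace V]

theorem continuous_gradient {φ : V → ℝ} (hφ : ContDiff ℝ 1 φ) : Continuous (gradient φ) :=
  (InnerProductSpace.toDual ℝ V).symm.continuous.comp (hφ.continuous_fderiv one_ne_zero)

/-- The fundamental theorem of calculus and Cauchy-Schwarz along the segment. The gradient integral
runs up to `L` rather than `t`, so that it stays constant when the bound is averaged over `t`. -/
theorem enorm_sq_le_along_segment {φ : V → ℝ} (hφ : ContDiff ℝ 1 φ) (x e : V) {t L : ℝ}
    (ht : 0 ≤ t) (htL : t ≤ L) :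
    ‖φ x‖ₑ ^ 2 ≤ 2 * ‖φ (x + t • e)‖ₑ ^ 2
      + 2 * (ENNReal.ofReal L * (‖e‖ₑ ^ 2
        * ∫⁻ s in Ioc 0 L, ‖gradient φ (x + s • e)‖ₑ ^ 2)) := by
  refine (enorm_sq_le_two_mul _ (φ (x + t • e))).trans ?_
  gcongr
  set f : ℝ → ℝ := fun s => φ (x + s • e) with hf
  have hfc : ContDiff ℝ 1 f := by fun_prop
  have hderiv : ∀ s, deriv f s = inner ℝ (gradient φ (x + s • e)) e := fun s => by
    have h1 : HasFDerivAt φ (fderiv ℝ φ (x + s • e)) (x + s • e) :=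
      (hφ.differentiable one_ne_zero _).hasFDerivAt
    have h2 : HasDerivAt (fun s : ℝ => x + s • e) e s := by
      simpa using ((hasDerivAt_id s).smul_const e).const_add x
    rw [gradient, InnerProductSpace.toDual_symm_apply]
    exact (h1.comp_hasDerivAt s h2).deriv
  have h0 : φ x = f 0 := by simp [hf]
  rw [h0]
  refine (enorm_sub_sq_le_lintegral_deriv hfc ht).trans ?_
  have hg : Continuous fun s : ℝ => gradient φ (x + s • e) :=
    (continuous_gradient hφ).comp (by fun_prop)
  rw [sub_zero, ← lintegral_const_mul (‖e‖ₑ ^ 2) (hg.enorm.measurable.pow_const 2)]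
  refine mul_le_mul' (ENNReal.ofReal_le_ofReal htL) ?_
  · refine (lintegral_mono_set (Ioc_subset_Ioc_right htL)).trans ?_
    refine lintegral_mono fun s => ?_
    rw [hderiv, ← mul_pow]
    gcongr
    rw [mul_comm, ← ofReal_norm, ← ofReal_norm, ← ofReal_norm, ← ENNReal.ofReal_mul (norm_nonneg _)]
    exact ENNReal.ofReal_le_ofReal (norm_inner_le_norm _ _)

end Segments

/-! ### A Poincaré inequality -/

variable {n : ℕ} {Ω D S T : Set (E n)}

/-- On `S ∩ Ω` the `L²` norm is controlled by the gradient on `Ω` and the `L²` norm on `D`. -/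
def L2Controlled (Ω D S : Set (E n)) : Prop :=
  ∃ C : ℝ≥0∞, C ≠ ⊤ ∧ ∀ φ : E n → ℝ, ContDiff ℝ 1 φ →
    ∫⁻ x in S ∩ Ω, ‖φ x‖ₑ ^ 2
      ≤ C * ((∫⁻ x in Ω, ‖gradient φ x‖ₑ ^ 2) + ∫⁻ x in D, ‖φ x‖ₑ ^ 2)

namespace L2Controlled

theorem mono (h : L2Controlled Ω D T) (hST : S ∩ Ω ⊆ T) : L2Controlled Ω D S := by
  obtain ⟨C, hC, h⟩ := h
  exact ⟨C, hC, fun φ hφ =>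
    (lintegral_mono_set (subset_inter hST inter_subset_right)).trans (h φ hφ)⟩

theorem empty : L2Controlled Ω D ∅ := ⟨0, by simp, by simp⟩

theorem union (hS : L2Controlled Ω D S) (hT : L2Controlled Ω D T) : L2Controlled Ω D (S ∪ T) := by
  obtain ⟨C₁, hC₁, h₁⟩ := hS
  obtain ⟨C₂, hC₂, h₂⟩ := hT
  refine ⟨C₁ + C₂, by finiteness, fun φ hφ => ?_⟩
  rw [union_inter_distrib_right, add_mul]
  exact (lintegral_union_le _ _ _).trans (add_le_add (h₁ φ hφ) (h₂ φ hφ))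

theorem of_subset (hS : S ∩ Ω ⊆ D) : L2Controlled Ω D S :=
  ⟨1, by simp, fun φ _ => by
    rw [one_mul]; exact (lintegral_mono_set hS).trans le_add_self⟩

/-- Compare `φ x` with `φ (x + v)` along the joining segment and integrate over `x`. By Fubini and
translation invariance the segment term is at most the gradient integral over `Ω`, because every
translated point stays in `Ω`. -/
theorem of_translate (hΩ : MeasurableSet Ω) (hS : MeasurableSet S) (hT : MeasurableSet T)
    (v : E n) (hv : ∀ x ∈ S ∩ Ω, ∀ t ∈ Icc (0 : ℝ) 1, x + t • v ∈ Ω)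
    (hvT : ∀ x ∈ S ∩ Ω, x + v ∈ T) (h : L2Controlled Ω D T) : L2Controlled Ω D S := by
  obtain ⟨C, hC, h⟩ := h
  refine ⟨2 * C + 2 * ‖v‖ₑ ^ 2, by finiteness, fun φ hφ => ?_⟩
  have hcφ : Continuous φ := hφ.continuous
  have hgφ : Continuous (gradient φ) := continuous_gradient hφ
  have hmφ := hcφ.measurable
  have hmg := hgφ.measurable
  have hSm := hS.inter hΩ
  -- integrals over translates of `S ∩ Ω`
  have key : ∀ (F : E n → ℝ≥0∞), Measurable F → ∀ (w : E n) (U : Set (E n)), MeasurableSet U →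
      (∀ x ∈ S ∩ Ω, x + w ∈ U) → ∫⁻ x in S ∩ Ω, F (x + w) ≤ ∫⁻ x in U, F x := by
    intro F hF w U hU hw
    rw [← lintegral_indicator hU, ← lintegral_indicator hSm,
      ← lintegral_add_right_eq_self (fun x => U.indicator F x) w]
    refine lintegral_mono fun x => ?_
    by_cases hx : x ∈ S ∩ Ω
    · simp [indicator_of_mem hx, indicator_of_mem (hw x hx)]
    · simp [indicator_of_notMem hx]
  calc ∫⁻ x in S ∩ Ω, ‖φ x‖ₑ ^ 2
      ≤ ∫⁻ x in S ∩ Ω, (2 * ‖φ (x + v)‖ₑ ^ 2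
          + 2 * ‖v‖ₑ ^ 2 * ∫⁻ s in Ioc (0 : ℝ) 1, ‖gradient φ (x + s • v)‖ₑ ^ 2) := by
        refine lintegral_mono fun x => ?_
        have := enorm_sq_le_along_segment hφ x v (t := 1) (L := 1) zero_le_one le_rfl
        simpa [mul_assoc] using this
    _ = 2 * (∫⁻ x in S ∩ Ω, ‖φ (x + v)‖ₑ ^ 2)
          + 2 * ‖v‖ₑ ^ 2 * ∫⁻ s in Ioc (0 : ℝ) 1, ∫⁻ x in S ∩ Ω, ‖gradient φ (x + s • v)‖ₑ ^ 2 := by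
        rw [lintegral_add_left (by fun_prop), lintegral_const_mul _ (by fun_prop),
          lintegral_const_mul, lintegral_lintegral_swap]
        · have : Continuous fun p : E n × ℝ => gradient φ (p.1 + p.2 • v) :=
            hgφ.comp (by fun_prop)
          have := this.measurable
          exact Measurable.aemeasurable (by fun_prop)
        · have : Continuous fun p : E n × ℝ => gradient φ (p.1 + p.2 • v) :=
            hgφ.comp (by fun_prop)
          have := this.measurable
          exact Measurable.lintegral_prod_right'
            (f := fun p : E n × ℝ => ‖gradient φ (p.1 + p.2 • v)‖ₑ ^ 2) (by fun_prop)
    _ ≤ 2 * (∫⁻ x in T ∩ Ω, ‖φ x‖ₑ ^ 2)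
          + 2 * ‖v‖ₑ ^ 2 * ∫⁻ s in Ioc (0 : ℝ) 1, ∫⁻ x in Ω, ‖gradient φ x‖ₑ ^ 2 := by
        gcongr 2 * ?_ + _ * ?_
        · refine key (fun x => ‖φ x‖ₑ ^ 2) (by fun_prop) v _ (hT.inter hΩ) fun x hx =>
            ⟨hvT x hx, by simpa using hv x hx 1 (by simp)⟩
        · refine setLIntegral_mono' measurableSet_Ioc fun s hs => ?_
          exact key (fun x => ‖gradient φ x‖ₑ ^ 2) (by fun_prop) (s • v) _ hΩ fun x hx =>
            hv x hx s (Ioc_subset_Icc_self hs)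
    _ ≤ 2 * (C * ((∫⁻ x in Ω, ‖gradient φ x‖ₑ ^ 2) + ∫⁻ x in D, ‖φ x‖ₑ ^ 2))
          + 2 * ‖v‖ₑ ^ 2 * ((∫⁻ x in Ω, ‖gradient φ x‖ₑ ^ 2) + ∫⁻ x in D, ‖φ x‖ₑ ^ 2) := by
        gcongr
        · exact h φ hφ
        · simp
    _ = _ := by ring

theorem of_isCompact {K : Set (E n)} (hK : IsCompact K)
    (h : ∀ z ∈ K, ∃ U ∈ 𝓝 z, L2Controlled Ω D U) : L2Controlled Ω D K := by
  refine hK.induction_on empty (fun s t hst ht => ht.mono (inter_subset_left.trans hst))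
    (fun s t hs ht => hs.union ht) fun z hz => ?_
  obtain ⟨U, hU, h⟩ := h z hz
  exact ⟨U, mem_nhdsWithin_of_mem_nhds hU, h⟩

/-- Interior points: the controlled points form a relatively clopen subset of `Ω`. -/
theorem exists_nhds_of_mem (hΩo : IsOpen Ω) (hΩc : IsPreconnected Ω) (hDo : IsOpen D)
    (hDne : D.Nonempty) (hDΩ : D ⊆ Ω) : ∀ z ∈ Ω, ∃ U ∈ 𝓝 z, L2Controlled Ω D U := by
  have hsub : Ω ⊆ {z | ∃ U ∈ 𝓝 z, L2Controlled Ω D U} := by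
    refine hΩc.subset_of_closure_inter_subset ?_ ?_ ?_
    · rw [isOpen_iff_mem_nhds]
      rintro z ⟨U, hU, h⟩
      filter_upwards [eventually_mem_nhds_iff.2 hU] with y hy using ⟨U, hy, h⟩
    · obtain ⟨z, hz⟩ := hDne
      exact ⟨z, hDΩ hz, D, hDo.mem_nhds hz, of_subset inter_subset_left⟩
    · rintro z ⟨hzc, hzΩ⟩
      obtain ⟨r, hr, hrΩ⟩ := Metric.isOpen_iff.1 hΩo z hzΩ
      obtain ⟨y, ⟨U, hU, h⟩, hyz⟩ := Metric.mem_closure_iff.1 hzc (r / 2) (by linarith)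
      obtain ⟨ρ, hρ, hρU⟩ := Metric.mem_nhds_iff.1 hU
      -- Translation by `y - z` carries this ball into the controlled ball around `y`. The radius
      -- and the shift are each below `r / 2` or at most that, so the segments stay in `ball z r ⊆
      -- Ω`.
      refine ⟨Metric.ball z (min ρ (r / 2)), Metric.ball_mem_nhds _ (by positivity), ?_⟩
      refine of_translate (T := Metric.ball y ρ) hΩo.measurableSet measurableSet_ball
        measurableSet_ball (y - z) ?_ ?_ (h.mono (inter_subset_left.trans hρU))
      · rintro x ⟨hx, -⟩ t ht
        apply hrΩ
        rw [Metric.mem_ball, dist_eq_norm] at hx ⊢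
        rw [dist_comm, dist_eq_norm] at hyz
        calc ‖x + t • (y - z) - z‖ = ‖(x - z) + t • (y - z)‖ := by congr 1; abel
          _ ≤ ‖x - z‖ + |t| * ‖y - z‖ := by
            refine (norm_add_le _ _).trans ?_
            rw [norm_smul, Real.norm_eq_abs]
          _ ≤ ‖x - z‖ + 1 * ‖y - z‖ := by
            gcongr; rw [abs_of_nonneg ht.1]; exact ht.2
          _ < r := by
            have := hx.trans_le (min_le_right _ _)
            linarith
      · rintro x ⟨hx, -⟩
        rw [Metric.mem_ball, dist_eq_norm] at hx ⊢
        rw [show x + (y - z) - y = x - z by abel]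
        exact hx.trans_le (min_le_left _ _)
  exact hsub

end L2Controlled

/-! ### Graph coordinates -/

/-- The point of `E n` with first coordinates `y` and last coordinate `τ`. -/
noncomputable def ofCoords (y : EuclideanSpace ℝ (Fin n)) (τ : ℝ) : E n :=
  WithLp.toLp 2 ((Fin.last n).insertNth (α := fun _ => ℝ) τ (WithLp.ofLp y))

@[simp] theorem firstCoords_ofCoords (y : EuclideanSpace ℝ (Fin n)) (τ : ℝ) :
    firstCoords (ofCoords y τ) = y := by
  ext i
  simp [firstCoords, ofCoords]

@[simp] theorem ofCoords_last (y : EuclideanSpace ℝ (Fin n)) (τ : ℝ) :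
    ofCoords y τ (Fin.last n) = τ := by
  simp [ofCoords]

@[simp] theorem ofCoords_firstCoords (x : E n) : ofCoords (firstCoords x) (x (Fin.last n)) = x := by
  ext i
  refine Fin.lastCases ?_ (fun j => ?_) i
  · simp
  · have := congrArg (fun y : EuclideanSpace ℝ (Fin n) => y j)
      (firstCoords_ofCoords (firstCoords x) (x (Fin.last n)))
    simpa [firstCoords] using this

theorem ofCoords_add (y : EuclideanSpace ℝ (Fin n)) (τ t : ℝ) :
    ofCoords y (τ + t) = ofCoords y τ + t • EuclideanSpace.single (Fin.last n) 1 := by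
  rw [← ofCoords_firstCoords (ofCoords y τ + t • EuclideanSpace.single (Fin.last n) 1)]
  congr 1
  · conv_lhs => rw [← firstCoords_ofCoords y τ]
    ext i
    simp [firstCoords]
  · simp

theorem measurePreserving_ofCoords :
    MeasurePreserving (fun p : EuclideanSpace ℝ (Fin n) × ℝ => ofCoords p.1 p.2)
      (volume.prod volume) volume := by
  have h1 := (PiLp.volume_preserving_ofLp (Fin n)).prod (MeasurePreserving.id (volume : Measure ℝ))
  have h2 : MeasurePreserving Prod.swap ((volume : Measure (Fin n → ℝ)).prod (volume : Measure ℝ))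
    ((volume : Measure ℝ).prod (volume : Measure (Fin n → ℝ))) := Measure.measurePreserving_swap
  have h3 := (volume_preserving_piFinSuccAbove (fun _ : Fin (n + 1) => ℝ) (Fin.last n)).symm
  exact (PiLp.volume_preserving_toLp (Fin (n + 1))).comp (h3.comp (h2.comp h1))

theorem norm_firstCoords_le (x : E n) : ‖firstCoords x‖ ≤ ‖x‖ := by
  rw [EuclideanSpace.norm_eq, EuclideanSpace.norm_eq, Fin.sum_univ_castSucc]
  apply Real.sqrt_le_sqrt
  simp only [firstCoords]
  linarith [sq_nonneg ‖x (Fin.last n)‖]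

theorem contDiff_ofCoords {γ : EuclideanSpace ℝ (Fin n) → ℝ} (hγ : ContDiff ℝ 1 γ) :
    ContDiff ℝ 1 (fun y => ofCoords y (γ y)) := by
  rw [contDiff_euclidean]
  intro i
  refine Fin.lastCases ?_ (fun j => ?_) i
  · simpa using hγ
  · have : ∀ y : EuclideanSpace ℝ (Fin n), ofCoords y (γ y) j.castSucc = y j := fun y => by
      have := congrArg (fun z : EuclideanSpace ℝ (Fin n) => z j) (firstCoords_ofCoords y (γ y))
      simpa [firstCoords] using this
    simp only [this]
    fun_prop

/-- The defining property of a smooth boundary at a point `z`. -/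
def IsGraphChart (Ω : Set (E n)) (z : E n) (ε : ℝ) (R : E n ≃ₗᵢ[ℝ] E n)
    (γ : EuclideanSpace ℝ (Fin n) → ℝ) : Prop :=
  (∀ x ∈ Metric.ball z ε, (x ∈ frontier Ω ↔ R x (Fin.last n) = γ (firstCoords (R x)))) ∧
    (∀ x ∈ Metric.ball z ε, (x ∈ Ω ↔ γ (firstCoords (R x)) < R x (Fin.last n)))

/-- The direction pointing into the domain. -/
noncomputable def vertical (R : E n ≃ₗᵢ[ℝ] E n) : E n :=
  R.symm (EuclideanSpace.single (Fin.last n) 1)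

@[simp] theorem norm_vertical (R : E n ≃ₗᵢ[ℝ] E n) : ‖vertical R‖ = 1 := by
  simp [vertical]

theorem map_add_vertical (R : E n ≃ₗᵢ[ℝ] E n) (x : E n) (t : ℝ) :
    R (x + t • vertical R) = ofCoords (firstCoords (R x)) (R x (Fin.last n) + t) := by
  rw [ofCoords_add, ofCoords_firstCoords]
  simp [vertical]

/-- A point of the closure lies on or above the graph, so any positive upward shift that stays in
the chart ball puts it strictly above. -/
theorem IsGraphChart.add_vertical_mem {z : E n} {ε : ℝ} {R : E n ≃ₗᵢ[ℝ] E n}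
    {γ : EuclideanSpace ℝ (Fin n) → ℝ} (h : IsGraphChart Ω z ε R γ) {x : E n}
    (hx : x ∈ closure Ω) (hxz : dist x z ≤ ε / 2) {t : ℝ} (ht : 0 < t) (htε : t < ε / 2) :
    x + t • vertical R ∈ Ω := by
  have hxb : x ∈ Metric.ball z ε := by rw [Metric.mem_ball]; linarith
  have hxt : x + t • vertical R ∈ Metric.ball z ε := by
    rw [Metric.mem_ball, dist_eq_norm] at *
    calc ‖x + t • vertical R - z‖ = ‖(x - z) + t • vertical R‖ := by congr 1; abel
      _ ≤ ‖x - z‖ + ‖t • vertical R‖ := norm_add_le _ _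
      _ < ε := by rw [norm_smul, norm_vertical, Real.norm_of_nonneg ht.le]; linarith
  have hle : γ (firstCoords (R x)) ≤ R x (Fin.last n) := by
    rcases (closure_eq_self_union_frontier Ω ▸ hx : x ∈ Ω ∪ frontier Ω) with hx | hx
    · exact ((h.2 x hxb).1 hx).le
    · exact ((h.1 x hxb).1 hx).ge
  rw [h.2 _ hxt, map_add_vertical]
  simp only [firstCoords_ofCoords, ofCoords_last]
  linarith

/-! ### The Poincaré inequality up to the boundary -/

/-- Near a boundary point, the shift by `ε / 4` in the vertical direction maps the closure of `Ω`
onto a compact subset of `Ω`, which finitely many interior neighbourhoods control. Compactness of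
`closure Ω` then makes the bound global. -/
theorem l2Controlled_univ (hΩ : IsSmoothBoundedDomain Ω) (hDo : IsOpen D)
    (hDne : D.Nonempty) (hDΩ : D ⊆ Ω) : L2Controlled Ω D univ := by
  have hint := L2Controlled.exists_nhds_of_mem hΩ.isOpen hΩ.isConnected.isPreconnected hDo hDne hDΩ
  have hcpt : IsCompact (closure Ω) := hΩ.isBounded.isCompact_closure
  refine (L2Controlled.of_isCompact hcpt fun z hz => ?_).mono (by simpa using subset_closure)
  rcases (closure_eq_self_union_frontier Ω ▸ hz : z ∈ Ω ∪ frontier Ω) with hz | hz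
  · exact hint z hz
  obtain ⟨ε, hε, R, γ, -, hR⟩ := hΩ.smoothBoundary z hz
  have hR : IsGraphChart Ω z ε R γ := hR
  have hK : IsCompact ((fun x => x + (ε / 4) • vertical R) ''
      (closure Ω ∩ Metric.closedBall z (ε / 2))) :=
    (hcpt.inter_right Metric.isClosed_closedBall).image (by fun_prop)
  refine ⟨Metric.ball z (ε / 2), Metric.ball_mem_nhds _ (by positivity), ?_⟩
  refine L2Controlled.of_translate hΩ.isOpen.measurableSet measurableSet_ball hK.measurableSet
    ((ε / 4) • vertical R) ?_ ?_ (L2Controlled.of_isCompact hK ?_)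
  · rintro x ⟨hx, hxΩ⟩ t ht
    rw [smul_smul]
    rcases ht.1.eq_or_lt with rfl | h0
    · simpa using hxΩ
    · exact hR.add_vertical_mem (subset_closure hxΩ) (Metric.mem_ball.1 hx).le (by positivity)
        (by nlinarith [ht.2])
  · rintro x ⟨hx, hxΩ⟩
    exact ⟨x, ⟨subset_closure hxΩ, Metric.ball_subset_closedBall hx⟩, rfl⟩
  · rintro _ ⟨x, ⟨hx, hxz⟩, rfl⟩
    exact hint _ (hR.add_vertical_mem hx hxz (by positivity) (by linarith))

/-! ### The trace inequality -/

/-- The normalizing factor depends only on `d`, so it is the same on both sides. -/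
theorem euclideanHausdorffMeasure_image_le {X Y : Type*} [EMetricSpace X] [MeasurableSpace X]
    [BorelSpace X] [EMetricSpace Y] [MeasurableSpace Y] [BorelSpace Y] {K : NNReal} {f : X → Y}
    {s : Set X} (h : LipschitzOnWith K f s) (d : ℕ) :
    (Measure.euclideanHausdorffMeasure d : Measure Y) (f '' s)
      ≤ (K : ℝ≥0∞) ^ d * (Measure.euclideanHausdorffMeasure d : Measure X) s := by
  have := h.hausdorffMeasure_image_le (d := d) (by positivity)
  rw [Measure.euclideanHausdorffMeasure_def, Measure.euclideanHausdorffMeasure_def,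
    Measure.smul_apply, Measure.smul_apply, mul_smul_comm]
  rw [ENNReal.rpow_natCast] at this
  simp only [ENNReal.smul_def, smul_eq_mul]
  gcongr

/-- Integrals over a Lipschitz image, against the Hausdorff measure. -/
theorem setLIntegral_image_le {d : ℕ} {Y : Type*} [EMetricSpace Y] [MeasurableSpace Y]
    [BorelSpace Y] {K : NNReal} {f : EuclideanSpace ℝ (Fin d) → Y} (hf : Measurable f)
    {s : Set (EuclideanSpace ℝ (Fin d))} (h : LipschitzOnWith K f s)
    {F : Y → ℝ≥0∞} (hF : Measurable F) :
    ∫⁻ y in f '' s, F y ∂(Measure.euclideanHausdorffMeasure d)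
      ≤ (K : ℝ≥0∞) ^ d * ∫⁻ x in s, F (f x) := by
  have hle : (Measure.euclideanHausdorffMeasure d).restrict (f '' s)
      ≤ ((K : ℝ≥0∞) ^ d) • Measure.map f (volume.restrict s) := by
    refine Measure.le_iff.2 fun t ht => ?_
    rw [Measure.restrict_apply ht, Measure.smul_apply, Measure.map_apply hf ht,
      Measure.restrict_apply (hf ht), smul_eq_mul]
    have hsub : t ∩ f '' s ⊆ f '' (f ⁻¹' t ∩ s) := by
      rintro _ ⟨ht, x, hx, rfl⟩
      exact ⟨x, ⟨ht, hx⟩, rfl⟩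
    refine (measure_mono hsub).trans ?_
    rw [← EuclideanSpace.euclideanHausdorffMeasure_eq_volume]
    exact euclideanHausdorffMeasure_image_le (h.mono inter_subset_right) d
  calc _ ≤ ∫⁻ y, F y ∂(((K : ℝ≥0∞) ^ d) • Measure.map f (volume.restrict s)) :=
        lintegral_mono' hle le_rfl
    _ = _ := by rw [lintegral_smul_measure, lintegral_map hF hf, smul_eq_mul]

/-- The boundary values on `S` are controlled by the `H¹(Ω)` norm. -/
def TraceControlled (Ω S : Set (E n)) : Prop :=
  ∃ C : ℝ≥0∞, C ≠ ⊤ ∧ ∀ φ : E n → ℝ, ContDiff ℝ 1 φ →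
    ∫⁻ x in S, ‖φ x‖ₑ ^ 2 ∂(surfaceMeasure Ω)
      ≤ C * ((∫⁻ x in Ω, ‖φ x‖ₑ ^ 2) + ∫⁻ x in Ω, ‖gradient φ x‖ₑ ^ 2)

/-- Average the segment estimate over its endpoint `t ∈ (0, δ]`; this trades a point value for an
integral, as a trace bound needs. -/
theorem enorm_sq_le_lintegral_segment {φ : E n → ℝ} (hφ : ContDiff ℝ 1 φ) (x e : E n)
    {δ : ℝ} (hδ : 0 < δ) :
    ‖φ x‖ₑ ^ 2 ≤ ((ENNReal.ofReal δ)⁻¹ * (2 + 2 * (ENNReal.ofReal δ ^ 2 * ‖e‖ₑ ^ 2)))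
      * ∫⁻ t in Ioc (0 : ℝ) δ, (‖φ (x + t • e)‖ₑ ^ 2 + ‖gradient φ (x + t • e)‖ₑ ^ 2) := by
  have hcφ : Continuous φ := hφ.continuous
  have hgφ : Continuous (gradient φ) := continuous_gradient hφ
  have hδ0 : ENNReal.ofReal δ ≠ 0 := by simpa using hδ
  have h1 : Measurable fun t : ℝ => ‖φ (x + t • e)‖ₑ ^ 2 :=
    (hcφ.comp (by fun_prop)).enorm.measurable.pow_const 2
  set I₁ := ∫⁻ t in Ioc (0 : ℝ) δ, ‖φ (x + t • e)‖ₑ ^ 2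
  set I₂ := ∫⁻ t in Ioc (0 : ℝ) δ, ‖gradient φ (x + t • e)‖ₑ ^ 2 with hI₂
  have h2 : ENNReal.ofReal δ * ‖φ x‖ₑ ^ 2
      ≤ 2 * I₁ + ENNReal.ofReal δ * (2 * (ENNReal.ofReal δ * (‖e‖ₑ ^ 2 * I₂))) := by
    calc ENNReal.ofReal δ * ‖φ x‖ₑ ^ 2 = ∫⁻ t in Ioc (0 : ℝ) δ, ‖φ x‖ₑ ^ 2 := by
          simp [mul_comm]
      _ ≤ ∫⁻ t in Ioc (0 : ℝ) δ, (2 * ‖φ (x + t • e)‖ₑ ^ 2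
            + 2 * (ENNReal.ofReal δ * (‖e‖ₑ ^ 2 * I₂))) :=
          setLIntegral_mono' measurableSet_Ioc fun t ht =>
            enorm_sq_le_along_segment hφ x e ht.1.le ht.2
      _ = _ := by
          rw [lintegral_add_left (h1.const_mul 2), lintegral_const_mul _ h1, setLIntegral_const,
            Real.volume_Ioc, sub_zero]
          change 2 * I₁ + _ = _
          ring
  rw [lintegral_add_left h1]
  calc ‖φ x‖ₑ ^ 2 = (ENNReal.ofReal δ)⁻¹ * (ENNReal.ofReal δ * ‖φ x‖ₑ ^ 2) := by
        rw [← mul_assoc, ENNReal.inv_mul_cancel hδ0 (by simp), one_mul]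
    _ ≤ (ENNReal.ofReal δ)⁻¹ *
        (2 * I₁ + ENNReal.ofReal δ * (2 * (ENNReal.ofReal δ * (‖e‖ₑ ^ 2 * I₂)))) := by gcongr
    _ = (ENNReal.ofReal δ)⁻¹ *
        (2 * I₁ + 2 * (ENNReal.ofReal δ ^ 2 * ‖e‖ₑ ^ 2) * I₂) := by ring
    -- Adding the missing cross terms gives `I₁` and `I₂` a common factor.
    _ ≤ (ENNReal.ofReal δ)⁻¹ *
        ((2 * I₁ + 2 * (ENNReal.ofReal δ ^ 2 * ‖e‖ₑ ^ 2) * I₂)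
          + (2 * I₂ + 2 * (ENNReal.ofReal δ ^ 2 * ‖e‖ₑ ^ 2) * I₁)) := by
        exact mul_le_mul_right le_self_add _
    _ = _ := by ring

namespace IsGraphChart

/-- The graph map `G` is Lipschitz on a compact ball, so surface measure is dominated by Lebesgue
measure in the parameter `y`. Bounding each boundary value by an integral over its inward vertical
segment yields an integral in `(y, τ)`, which Fubini and a rigid motion turn into one over `Ω`. -/
theorem traceControlled {z : E n} {ε : ℝ} (hε : 0 < ε) {R : E n ≃ₗᵢ[ℝ] E n}
    {γ : EuclideanSpace ℝ (Fin n) → ℝ} (h : IsGraphChart Ω z ε R γ) (hΩ : MeasurableSet Ω)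
    (hγ : ContDiff ℝ 1 γ) : TraceControlled Ω (Metric.ball z (ε / 2)) := by
  set G : EuclideanSpace ℝ (Fin n) → E n := fun y => R.symm (ofCoords y (γ y)) with hG
  have hGd : ContDiff ℝ 1 G :=
    R.symm.toContinuousLinearEquiv.contDiff.comp (contDiff_ofCoords hγ)
  set B : Set (EuclideanSpace ℝ (Fin n)) :=
    Metric.closedBall (firstCoords (R z)) ε ∩ G ⁻¹' Metric.ball z (ε / 2) with hB
  have hBm : MeasurableSet B :=
    measurableSet_closedBall.inter (hGd.continuous.measurable measurableSet_ball)
  obtain ⟨K, hK⟩ := (hGd.locallyLipschitz.locallyLipschitzOn (s := Metric.closedBall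
    (firstCoords (R z)) ε)).exists_lipschitzOnWith_of_compact (isCompact_closedBall _ _)
  set δ := ε / 4 with hδ
  have hδ0 : 0 < δ := by positivity
  set C := (ENNReal.ofReal δ)⁻¹ * (2 + 2 * (ENNReal.ofReal δ ^ 2 * ‖vertical R‖ₑ ^ 2)) with hC
  have hδ1 : ENNReal.ofReal δ ≠ 0 := by simpa using hδ0
  refine ⟨C * (K : ℝ≥0∞) ^ n, by finiteness, fun φ hφ => ?_⟩
  have hcφ : Continuous φ := hφ.continuous
  have hgφ : Continuous (gradient φ) := continuous_gradient hφ
  set H : E n → ℝ≥0∞ := fun x => ‖φ x‖ₑ ^ 2 + ‖gradient φ x‖ₑ ^ 2 with hH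
  have hHm : Measurable H :=
    (hcφ.enorm.measurable.pow_const 2).add (hgφ.enorm.measurable.pow_const 2)
  have hΨm : Measurable fun x => ∫⁻ t in Ioc (0 : ℝ) δ, H (x + t • vertical R) :=
    Measurable.lintegral_prod_right'
      (f := fun p : E n × ℝ => H (p.1 + p.2 • vertical R)) (by fun_prop)
  have hsub : Metric.ball z (ε / 2) ∩ frontier Ω ⊆ G '' B := by
    rintro x ⟨hx, hxf⟩
    have hxb := Metric.ball_subset_ball (by linarith : ε / 2 ≤ ε) hx
    have hGx : G (firstCoords (R x)) = x := by
      rw [hG]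
      simp only
      rw [← (h.1 x hxb).1 hxf, ofCoords_firstCoords, R.symm_apply_apply]
    refine ⟨firstCoords (R x), ⟨?_, by rwa [mem_preimage, hGx]⟩, hGx⟩
    rw [Metric.mem_closedBall, dist_eq_norm]
    have : firstCoords (R x) - firstCoords (R z) = firstCoords (R (x - z)) := by
      ext i; simp [firstCoords]
    rw [this]
    refine (norm_firstCoords_le _).trans ?_
    rw [R.norm_map, ← dist_eq_norm]
    exact (Metric.mem_ball.1 hxb).le
  have hGadd : ∀ y t, G y + t • vertical R = R.symm (ofCoords y (γ y + t)) := fun y t => by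
    apply R.injective
    rw [map_add_vertical]
    simp [hG]
  have hGB : ∀ y ∈ B, ∀ t ∈ Ioc (0 : ℝ) δ, G y + t • vertical R ∈ Ω := by
    intro y hy t ht
    have hyb : G y ∈ Metric.ball z (ε / 2) := hy.2
    refine h.add_vertical_mem (frontier_subset_closure ?_) (Metric.mem_ball.1 hyb).le ht.1
      (by linarith [ht.2])
    rw [h.1 _ (Metric.ball_subset_ball (by linarith) hyb)]
    simp [hG]
  have hRm : Measurable R.symm := R.symm.continuous.measurable
  have hIm : Measurable (Ω.indicator H) := hHm.indicator hΩ
  have hRmp : MeasurePreserving R.symm volume volume := R.symm.measurePreserving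
  calc ∫⁻ x in Metric.ball z (ε / 2), ‖φ x‖ₑ ^ 2 ∂(surfaceMeasure Ω)
      ≤ ∫⁻ x in Metric.ball z (ε / 2),
          (C * ∫⁻ t in Ioc (0 : ℝ) δ, H (x + t • vertical R)) ∂(surfaceMeasure Ω) :=
        lintegral_mono fun x => enorm_sq_le_lintegral_segment hφ x _ hδ0
    _ = C * ∫⁻ x in Metric.ball z (ε / 2) ∩ frontier Ω,
          (∫⁻ t in Ioc (0 : ℝ) δ, H (x + t • vertical R))
            ∂(Measure.euclideanHausdorffMeasure n) := by
        rw [lintegral_const_mul _ hΨm, surfaceMeasure, Measure.restrict_restrict measurableSet_ball]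
    _ ≤ C * ∫⁻ x in G '' B, (∫⁻ t in Ioc (0 : ℝ) δ, H (x + t • vertical R))
            ∂(Measure.euclideanHausdorffMeasure n) := by
        gcongr
    _ ≤ C * ((K : ℝ≥0∞) ^ n * ∫⁻ y in B, ∫⁻ t in Ioc (0 : ℝ) δ, H (G y + t • vertical R)) := by
        gcongr
        exact setLIntegral_image_le hGd.continuous.measurable (hK.mono inter_subset_left) hΨm
    _ ≤ C * ((K : ℝ≥0∞) ^ n * ∫⁻ y, ∫⁻ τ, Ω.indicator H (R.symm (ofCoords y τ))) := by
        refine mul_le_mul_right (mul_le_mul_right ?_ _) _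
        refine (setLIntegral_mono' hBm fun y hy => ?_).trans (setLIntegral_le_lintegral B _)
        -- Substitute `τ = γ y + t`, so that height is measured from the graph.
        rw [← lintegral_add_left_eq_self (fun τ => Ω.indicator H (R.symm (ofCoords y τ))) (γ y)]
        refine le_trans (setLIntegral_mono' measurableSet_Ioc fun t ht => ?_)
          (setLIntegral_le_lintegral (Ioc (0 : ℝ) δ) _)
        rw [← hGadd, indicator_of_mem (hGB y hy t ht)]
    _ = C * ((K : ℝ≥0∞) ^ n * ∫⁻ x, Ω.indicator H x) := by
        congr 2
        have hm : Measurable fun x => Ω.indicator H (R.symm x) := hIm.comp hRm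
        rw [← hRmp.lintegral_comp hIm, ← measurePreserving_ofCoords.lintegral_comp hm,
          lintegral_prod]
        exact (hm.comp measurePreserving_ofCoords.measurable).aemeasurable
    _ = _ := by
        rw [lintegral_indicator hΩ, lintegral_add_left (hcφ.enorm.measurable.pow_const 2)]
        ring

end IsGraphChart

theorem traceControlled_univ (hΩ : IsSmoothBoundedDomain Ω) : TraceControlled Ω univ := by
  have hcpt : IsCompact (frontier Ω) :=
    hΩ.isBounded.isCompact_closure.of_isClosed_subset isClosed_frontier frontier_subset_closure
  have key : TraceControlled Ω (frontier Ω) := by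
    refine hcpt.induction_on ⟨0, by simp, by simp⟩ ?_ ?_ ?_
    · rintro s t hst ⟨C, hC, h⟩
      exact ⟨C, hC, fun φ hφ => (lintegral_mono_set hst).trans (h φ hφ)⟩
    · rintro s t ⟨C₁, hC₁, h₁⟩ ⟨C₂, hC₂, h₂⟩
      refine ⟨C₁ + C₂, by finiteness, fun φ hφ => ?_⟩
      rw [add_mul]
      exact (lintegral_union_le _ _ _).trans (add_le_add (h₁ φ hφ) (h₂ φ hφ))
    · intro z hz
      obtain ⟨ε, hε, R, γ, hγ, hR⟩ := hΩ.smoothBoundary z hz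
      exact ⟨_, mem_nhdsWithin_of_mem_nhds (Metric.ball_mem_nhds z (by positivity)),
        IsGraphChart.traceControlled hε hR hΩ.isOpen.measurableSet
          (hγ.of_le (by exact_mod_cast le_top))⟩
  obtain ⟨C, hC, h⟩ := key
  refine ⟨C, hC, fun φ hφ => ?_⟩
  have := h φ hφ
  rwa [surfaceMeasure, Measure.restrict_restrict_of_subset subset_rfl, ← surfaceMeasure,
    ← Measure.restrict_univ (μ := surfaceMeasure Ω)] at this

/-! ### The Hilbert space of functions, gradients and boundary values -/

section Lp

variable {α F : Type*} [MeasurableSpace α] {μ : Measure α} [NormedAddCommGroup F]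

theorem eLpNorm_two_sq (f : α → F) : eLpNorm f 2 μ ^ 2 = ∫⁻ x, ‖f x‖ₑ ^ 2 ∂μ := by
  simpa using eLpNorm_nnreal_pow_eq_lintegral (f := f) (μ := μ) (p := 2) two_ne_zero

theorem ofReal_norm_sq_eq (f : Lp F 2 μ) {g : α → F} (h : f =ᵐ[μ] g) :
    ENNReal.ofReal (‖f‖ ^ 2) = ∫⁻ x, ‖g x‖ₑ ^ 2 ∂μ := by
  rw [← eLpNorm_two_sq, ← eLpNorm_congr_ae h, ENNReal.ofReal_pow (norm_nonneg _), ofReal_norm,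
    Lp.enorm_def]

/-- The real inner product as a continuous bilinear map. -/
noncomputable def realInnerL (V : Type*) [NormedAddCommGroup V] [InnerProductSpace ℝ V] :
    V →L[ℝ] V →L[ℝ] ℝ :=
  LinearMap.mkContinuous₂ (innerₗ V) 1 fun x y => by
    simpa using norm_inner_le_norm (𝕜 := ℝ) x y

@[simp] theorem realInnerL_apply {V : Type*} [NormedAddCommGroup V] [InnerProductSpace ℝ V]
    (x y : V) : realInnerL V x y = inner ℝ x y := rfl

/-- Multiplication of `L²` functions by an `L^∞` function. -/
noncomputable def mulL [NormedSpace ℝ F] (σ : Lp ℝ ⊤ μ) : Lp F 2 μ →L[ℝ] Lp F 2 μ :=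
  (ContinuousLinearMap.lsmul ℝ ℝ).holderL μ ⊤ 2 2 σ

theorem coeFn_mulL [NormedSpace ℝ F] (σ : Lp ℝ ⊤ μ) (f : Lp F 2 μ) :
    mulL σ f =ᵐ[μ] fun x => σ x • f x :=
  (ContinuousLinearMap.lsmul ℝ ℝ).coeFn_holder (r := 2) σ f

end Lp

/-- The space `L²(Ω) × L²(Ω; ℝ^(n+1)) × L²(∂Ω)`. -/
abbrev TripleSpace (Ω : Set (E n)) : Type :=
  WithLp 2 (WithLp 2 (Lp ℝ 2 (volume.restrict Ω) × Lp (E n) 2 (volume.restrict Ω)) × L2Boundary Ω)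

theorem gradient_add {φ ψ : E n → ℝ} (hφ : Differentiable ℝ φ) (hψ : Differentiable ℝ ψ) (x : E n) :
    gradient (φ + ψ) x = gradient φ x + gradient ψ x := by
  simp [gradient, fderiv_add (hφ x) (hψ x)]

theorem gradient_const_smul {φ : E n → ℝ} (hφ : Differentiable ℝ φ) (c : ℝ) (x : E n) :
    gradient (c • φ) x = c • gradient φ x := by
  simp [gradient, fderiv_const_smul (hφ x) c]

/-- The triple in question is made of a smooth function, its gradient and its boundary values. -/
def IsSmoothTriple (p : TripleSpace Ω) (φ : E n → ℝ) : Prop :=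
  ContDiff ℝ ∞ φ ∧ p.fst.fst =ᵐ[volume.restrict Ω] φ ∧
    p.fst.snd =ᵐ[volume.restrict Ω] gradient φ ∧ p.snd =ᵐ[surfaceMeasure Ω] φ

/-- The triples made of a smooth function, its gradient and its boundary values. -/
def smoothTriples (Ω : Set (E n)) : Submodule ℝ (TripleSpace Ω) where
  carrier := {p | ∃ φ, IsSmoothTriple p φ}
  add_mem' := by
    rintro p q ⟨φ, hφ, h1, h2, h3⟩ ⟨ψ, hψ, k1, k2, k3⟩
    refine ⟨φ + ψ, hφ.add hψ, ?_, ?_, ?_⟩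
    · exact (Lp.coeFn_add _ _).trans (h1.add k1)
    · refine (Lp.coeFn_add _ _).trans ((h2.add k2).trans (.of_forall fun x => ?_))
      exact (gradient_add (hφ.differentiable (by simp)) (hψ.differentiable (by simp)) x).symm
    · exact (Lp.coeFn_add _ _).trans (h3.add k3)
  zero_mem' := by
    refine ⟨0, contDiff_const, Lp.coeFn_zero _ _ _, ?_, Lp.coeFn_zero _ _ _⟩
    refine (Lp.coeFn_zero _ _ _).trans (.of_forall fun x => ?_)
    simp [gradient]
  smul_mem' := by
    rintro c p ⟨φ, hφ, h1, h2, h3⟩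
    refine ⟨c • φ, contDiff_const.smul hφ, ?_, ?_, ?_⟩
    · exact (Lp.coeFn_smul _ _).trans (h1.const_smul c)
    · refine (Lp.coeFn_smul _ _).trans ((h2.const_smul c).trans (.of_forall fun x => ?_))
      exact (gradient_const_smul (hφ.differentiable (by simp)) c x).symm
    · exact (Lp.coeFn_smul _ _).trans (h3.const_smul c)

/-- The space of the triples made of an `H¹` function, its gradient and its trace. -/
noncomputable def traceSpace (Ω : Set (E n)) : Submodule ℝ (TripleSpace Ω) :=
  (smoothTriples Ω).topologicalClosure

theorem tendsto_tripleSpace {p : ℕ → TripleSpace Ω} {q : TripleSpace Ω} :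
    Tendsto p atTop (𝓝 q) ↔ Tendsto (fun k => (p k).fst.fst) atTop (𝓝 q.fst.fst) ∧
      Tendsto (fun k => (p k).fst.snd) atTop (𝓝 q.fst.snd) ∧
      Tendsto (fun k => (p k).snd) atTop (𝓝 q.snd) := by
  constructor
  · intro h
    have h1 := ((WithLp.continuous_fst 2 _ _).tendsto q).comp h
    exact ⟨((WithLp.continuous_fst 2 _ _).tendsto q.fst).comp h1,
      ((WithLp.continuous_snd 2 _ _).tendsto q.fst).comp h1,
      ((WithLp.continuous_snd 2 _ _).tendsto q).comp h⟩
  · rintro ⟨h1, h2, h3⟩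
    have h4 := ((WithLp.prod_continuous_toLp 2 _ _).tendsto _).comp (h1.prodMk_nhds h2)
    exact ((WithLp.prod_continuous_toLp 2 _ _).tendsto _).comp (h4.prodMk_nhds h3)

theorem eLpNorm_sub_congr {α F : Type*} [MeasurableSpace α] {μ : Measure α}
    [NormedAddCommGroup F] {f g : Lp F 2 μ} {φ ψ : α → F} (h : f =ᵐ[μ] φ) (k : g =ᵐ[μ] ψ) :
    eLpNorm (⇑f - ⇑g) 2 μ = eLpNorm (fun x => φ x - ψ x) 2 μ :=
  eLpNorm_congr_ae (h.sub k)

theorem tendsto_Lp_congr {α F : Type*} [MeasurableSpace α] {μ : Measure α}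
    [NormedAddCommGroup F] {f : ℕ → Lp F 2 μ} {g : Lp F 2 μ} {φ : ℕ → α → F} {ψ : α → F}
    (h : ∀ k, f k =ᵐ[μ] φ k) (k : g =ᵐ[μ] ψ) :
    Tendsto f atTop (𝓝 g) ↔ Tendsto (fun k => eLpNorm (fun x => φ k x - ψ x) 2 μ) atTop (𝓝 0) := by
  rw [Lp.tendsto_Lp_iff_tendsto_eLpNorm']
  simp_rw [fun i => eLpNorm_sub_congr (h i) k]

theorem memLp_of_continuous (hΩ : IsSmoothBoundedDomain Ω) {F : Type*} [NormedAddCommGroup F]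
    {f : E n → F} (hf : Continuous f) : MemLp f 2 (volume.restrict Ω) := by
  have hcpt : IsCompact (closure Ω) := hΩ.isBounded.isCompact_closure
  obtain ⟨C, hC⟩ := hcpt.exists_bound_of_continuousOn hf.continuousOn
  have : IsFiniteMeasure (volume.restrict Ω) :=
    ⟨by simpa using hΩ.isBounded.measure_lt_top⟩
  refine MemLp.of_bound hf.aestronglyMeasurable C ?_
  filter_upwards [ae_restrict_mem hΩ.isOpen.measurableSet] with x hx using hC x (subset_closure hx)

theorem lintegral_lt_top_of_memLp {α F : Type*} [MeasurableSpace α] {μ : Measure α}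
    [NormedAddCommGroup F] {f : α → F} (hf : MemLp f 2 μ) : ∫⁻ x, ‖f x‖ₑ ^ 2 ∂μ < ⊤ := by
  rw [← eLpNorm_two_sq]
  exact ENNReal.pow_lt_top hf.2

/-- The trace inequality itself gives finiteness; finiteness of the surface measure is not needed.
-/
theorem memLp_surfaceMeasure (hΩ : IsSmoothBoundedDomain Ω) {φ : E n → ℝ} (hφ : ContDiff ℝ 1 φ) :
    MemLp φ 2 (surfaceMeasure Ω) := by
  refine ⟨hφ.continuous.aestronglyMeasurable, ?_⟩
  obtain ⟨C, hC, h⟩ := traceControlled_univ hΩ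
  have h1 := lintegral_lt_top_of_memLp (memLp_of_continuous hΩ hφ.continuous)
  have h2 := lintegral_lt_top_of_memLp (memLp_of_continuous hΩ (continuous_gradient hφ))
  have h3 := h φ hφ
  rw [Measure.restrict_univ, ← eLpNorm_two_sq] at h3
  have h4 : eLpNorm φ 2 (surfaceMeasure Ω) ^ 2 < ⊤ := h3.trans_lt (by finiteness)
  exact (ENNReal.pow_lt_top_iff.1 h4).resolve_right (by simp)

/-- The triple given by a smooth function. -/
theorem exists_isSmoothTriple (hΩ : IsSmoothBoundedDomain Ω) {φ : E n → ℝ} (hφ : ContDiff ℝ ∞ φ) :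
    ∃ p : TripleSpace Ω, IsSmoothTriple p φ := by
  have hφ1 : ContDiff ℝ 1 φ := hφ.of_le (by exact_mod_cast le_top)
  have h1 := memLp_of_continuous hΩ hφ1.continuous
  have h2 := memLp_of_continuous hΩ (continuous_gradient hφ1)
  have h3 := memLp_surfaceMeasure hΩ hφ1
  exact ⟨WithLp.toLp 2 (WithLp.toLp 2 (h1.toLp, h2.toLp), h3.toLp), hφ, h1.coeFn_toLp,
    h2.coeFn_toLp, h3.coeFn_toLp⟩

theorem hasTrace_of_mem {p : TripleSpace Ω} (hp : p ∈ traceSpace Ω) :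
    HasTrace Ω p.fst.fst p.fst.snd p.snd := by
  refine ⟨Lp.memLp _, Lp.memLp _, ?_⟩
  obtain ⟨q, hq, hqp⟩ := mem_closure_iff_seq_limit.1 hp
  choose φ hφ using hq
  obtain ⟨h1, h2, h3⟩ := tendsto_tripleSpace.1 hqp
  exact ⟨φ, fun k => (hφ k).1, ⟨(tendsto_Lp_congr (fun k => (hφ k).2.1) .rfl).1 h1,
    (tendsto_Lp_congr (fun k => (hφ k).2.2.1) .rfl).1 h2⟩,
    (tendsto_Lp_congr (fun k => (hφ k).2.2.2) .rfl).1 h3⟩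

theorem mem_of_hasTrace (hΩ : IsSmoothBoundedDomain Ω) {u : E n → ℝ} {Du : E n → E n}
    {f : L2Boundary Ω} (h : HasTrace Ω u Du f) :
    ∃ p ∈ traceSpace Ω, p.fst.fst =ᵐ[volume.restrict Ω] u ∧
      p.fst.snd =ᵐ[volume.restrict Ω] Du ∧ p.snd = f := by
  obtain ⟨hu, hDu, φ, hφ, ⟨h1, h2⟩, h3⟩ := h
  choose q hq using fun k => exists_isSmoothTriple hΩ (hφ k)
  refine ⟨WithLp.toLp 2 (WithLp.toLp 2 (hu.toLp, hDu.toLp), f), ?_, hu.coeFn_toLp,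
    hDu.coeFn_toLp, rfl⟩
  refine mem_closure_iff_seq_limit.2 ⟨q, fun k => ⟨φ k, hq k⟩, tendsto_tripleSpace.2 ⟨?_, ?_, ?_⟩⟩
  · exact (tendsto_Lp_congr (fun k => (hq k).2.1) hu.coeFn_toLp).2 h1
  · exact (tendsto_Lp_congr (fun k => (hq k).2.2.1) hDu.coeFn_toLp).2 h2
  · exact (tendsto_Lp_congr (fun k => (hq k).2.2.2) .rfl).2 h3

theorem norm_sq_fst (p : TripleSpace Ω) :
    ‖p.fst‖ ^ 2 = ‖p.fst.fst‖ ^ 2 + ‖p.fst.snd‖ ^ 2 := WithLp.prod_norm_sq_eq_of_L2 _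

theorem norm_sq_triple (p : TripleSpace Ω) :
    ‖p‖ ^ 2 = ‖p.fst.fst‖ ^ 2 + ‖p.fst.snd‖ ^ 2 + ‖p.snd‖ ^ 2 := by
  rw [WithLp.prod_norm_sq_eq_of_L2, norm_sq_fst]

theorem exists_norm_snd_le (hΩ : IsSmoothBoundedDomain Ω) :
    ∃ C : ℝ, ∀ p ∈ smoothTriples Ω, ‖p.snd‖ ≤ C * ‖p.fst‖ := by
  obtain ⟨C, hC, h⟩ := traceControlled_univ hΩ
  refine ⟨√C.toReal, ?_⟩
  rintro p ⟨φ, hφ, h1, h2, h3⟩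
  have h4 := h φ (hφ.of_le (by exact_mod_cast le_top))
  rw [Measure.restrict_univ, ← ofReal_norm_sq_eq _ h1, ← ofReal_norm_sq_eq _ h2,
    ← ofReal_norm_sq_eq _ h3, ← ENNReal.ofReal_add (by positivity) (by positivity), ← norm_sq_fst,
    ← ENNReal.ofReal_toReal hC, ← ENNReal.ofReal_mul ENNReal.toReal_nonneg,
    ENNReal.ofReal_le_ofReal_iff (by positivity)] at h4
  refine abs_le_of_sq_le_sq' ?_ (by positivity) |>.2
  rwa [mul_pow, Real.sq_sqrt ENNReal.toReal_nonneg]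

/-- By the trace inequality, the boundary values of an `H¹`-convergent smooth sequence are Cauchy in
`L²(∂Ω)`. -/
theorem IsH1.exists_hasTrace (hΩ : IsSmoothBoundedDomain Ω) {u : E n → ℝ} {Du : E n → E n}
    (h : IsH1 Ω u Du) : ∃ f : L2Boundary Ω, HasTrace Ω u Du f := by
  obtain ⟨hu, hDu, φ, hφ, h1, h2⟩ := h
  choose q hq using fun k => exists_isSmoothTriple hΩ (hφ k)
  obtain ⟨C, hC⟩ := exists_norm_snd_le hΩ
  have k1 := (tendsto_Lp_congr (fun k => (hq k).2.1) hu.coeFn_toLp).2 h1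
  have k2 := (tendsto_Lp_congr (fun k => (hq k).2.2.1) hDu.coeFn_toLp).2 h2
  have k3 : CauchySeq fun k => (q k).fst :=
    (((WithLp.prod_continuous_toLp 2 _ _).tendsto _).comp (k1.prodMk_nhds k2)).cauchySeq
  have k4 : CauchySeq fun k => (q k).snd := by
    rw [cauchySeq_iff_tendsto_dist_atTop_0] at k3 ⊢
    refine squeeze_zero (fun _ => dist_nonneg) (fun m => ?_) (by simpa using k3.const_mul C)
    rw [dist_eq_norm, dist_eq_norm, ← WithLp.sub_snd, ← WithLp.sub_fst]
    exact hC _ (sub_mem ⟨φ m.1, hq m.1⟩ ⟨φ m.2, hq m.2⟩)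
  obtain ⟨f, hf⟩ := cauchySeq_tendsto_of_complete k4
  exact ⟨f, hu, hDu, φ, hφ, ⟨h1, h2⟩, (tendsto_Lp_congr (fun k => (hq k).2.2.2) .rfl).1 hf⟩

theorem HasTrace.isH1 {u : E n → ℝ} {Du : E n → E n} {f : L2Boundary Ω} (h : HasTrace Ω u Du f) :
    IsH1 Ω u Du := by
  obtain ⟨hu, hDu, φ, hφ, h1, -⟩ := h
  exact ⟨hu, hDu, φ, hφ, h1⟩

/-! ### Existence of weak solutions -/

/-- The bilinear form of the boundary value problem. -/
noncomputable def weakForm (σ q : Lp ℝ ⊤ (volume.restrict Ω)) :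
    TripleSpace Ω →L[ℝ] TripleSpace Ω →L[ℝ] ℝ :=
  let π := WithLp.fstL 2 ℝ (WithLp 2 (Lp ℝ 2 (volume.restrict Ω) × Lp (E n) 2 (volume.restrict Ω)))
    (L2Boundary Ω)
  let πu := (WithLp.fstL 2 ℝ (Lp ℝ 2 (volume.restrict Ω)) (Lp (E n) 2 (volume.restrict Ω))).comp π
  let πD := (WithLp.sndL 2 ℝ (Lp ℝ 2 (volume.restrict Ω)) (Lp (E n) 2 (volume.restrict Ω))).comp π
  (realInnerL _).bilinearComp ((mulL σ).comp πD) πD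
    + (realInnerL _).bilinearComp ((mulL q).comp πu) πu

theorem weakForm_apply {σ q : E n → ℝ} (hσ : MemLp σ ⊤ (volume.restrict Ω))
    (hq : MemLp q ⊤ (volume.restrict Ω)) {p r : TripleSpace Ω} {u w : E n → ℝ} {Du Dw : E n → E n}
    (hu : p.fst.fst =ᵐ[volume.restrict Ω] u) (hDu : p.fst.snd =ᵐ[volume.restrict Ω] Du)
    (hw : r.fst.fst =ᵐ[volume.restrict Ω] w) (hDw : r.fst.snd =ᵐ[volume.restrict Ω] Dw) :
    weakForm hσ.toLp hq.toLp p r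
      = (∫ x in Ω, σ x * inner ℝ (Du x) (Dw x)) + ∫ x in Ω, q x * (u x * w x) := by
  change inner ℝ (mulL hσ.toLp p.fst.snd) r.fst.snd + inner ℝ (mulL hq.toLp p.fst.fst) r.fst.fst = _
  rw [L2.inner_def, L2.inner_def]
  congr 1
  · refine integral_congr_ae ?_
    filter_upwards [coeFn_mulL hσ.toLp p.fst.snd, hσ.coeFn_toLp, hDu, hDw] with x h1 h2 h3 h4
    rw [h1, h2, h3, h4, real_inner_smul_left]
  · refine integral_congr_ae ?_
    filter_upwards [coeFn_mulL hq.toLp p.fst.fst, hq.coeFn_toLp, hu, hw] with x h1 h2 h3 h4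
    rw [h1, h2, h3, h4, real_inner_smul_left, real_inner_eq_re_inner ℝ]
    simp [mul_comm]

attribute [irreducible] weakForm

section Integrability

variable {α : Type*} [MeasurableSpace α] {μ : Measure α}

theorem integrable_coeff_inner {V : Type*} [NormedAddCommGroup V] [InnerProductSpace ℝ V]
    {σ : α → ℝ} (hσ : MemLp σ ⊤ μ) {v w : α → V} (hv : MemLp v 2 μ) (hw : MemLp w 2 μ) :
    Integrable (fun x => σ x * inner ℝ (v x) (w x)) μ :=
  (memLp_one_iff_integrable.1 ((realInnerL V).memLp_of_bilin 1 hv hw)).smul_of_top_right hσ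

theorem integrable_coeff_mul {q : α → ℝ} (hq : MemLp q ⊤ μ) {v w : α → ℝ} (hv : MemLp v 2 μ)
    (hw : MemLp w 2 μ) : Integrable (fun x => q x * (v x * w x)) μ :=
  (hv.integrable_mul hw).smul_of_top_right hq

theorem mul_setLIntegral_le_ofReal_integral {f F : α → ℝ} {c : ℝ} (hc : 0 ≤ c) {s : Set α}
    (hF : Integrable F μ) (hF0 : 0 ≤ᵐ[μ] F)
    (h : ∀ᵐ x ∂(μ.restrict s), c * f x ^ 2 ≤ F x) :
    ENNReal.ofReal c * ∫⁻ x in s, ‖f x‖ₑ ^ 2 ∂μ ≤ ENNReal.ofReal (∫ x, F x ∂μ) := by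
  rw [ofReal_integral_eq_lintegral_ofReal hF hF0, ← lintegral_const_mul' _ _ (by simp)]
  refine le_trans (lintegral_mono_ae ?_) (setLIntegral_le_lintegral s _)
  filter_upwards [h] with x hx
  rw [← ofReal_norm, ← ENNReal.ofReal_pow (norm_nonneg _), ← ENNReal.ofReal_mul hc,
    Real.norm_eq_abs, sq_abs]
  exact ENNReal.ofReal_le_ofReal hx

end Integrability

/-- On smooth functions the energy controls the `H¹` norm and the boundary values, if the
absorption is bounded below on an open subset. -/
theorem exists_energy_bound (hΩ : IsSmoothBoundedDomain Ω) (hDo : IsOpen D) (hDne : D.Nonempty)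
    (hDΩ : D ⊆ Ω) {σ q : E n → ℝ} {c : ℝ} (hc : 0 < c) (hσ : MemLp σ ⊤ (volume.restrict Ω))
    (hq : MemLp q ⊤ (volume.restrict Ω)) (hσc : ∀ᵐ x ∂(volume.restrict Ω), c ≤ σ x)
    (hq0 : ∀ᵐ x ∂(volume.restrict Ω), 0 ≤ q x) (hqc : ∀ᵐ x ∂(volume.restrict D), c ≤ q x) :
    ∃ K : ℝ, 0 < K ∧ ∀ φ : E n → ℝ, ContDiff ℝ 1 φ →
      ∃ b : ℝ, b = (∫ x in Ω, σ x * inner ℝ (gradient φ x) (gradient φ x))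
          + ∫ x in Ω, q x * (φ x * φ x) ∧
        0 ≤ b ∧ (∫⁻ x in Ω, ‖φ x‖ₑ ^ 2) + (∫⁻ x in Ω, ‖gradient φ x‖ₑ ^ 2)
          + (∫⁻ x, ‖φ x‖ₑ ^ 2 ∂(surfaceMeasure Ω)) ≤ ENNReal.ofReal (K * b) := by
  obtain ⟨C₁, hC₁, h₁⟩ := l2Controlled_univ hΩ hDo hDne hDΩ
  obtain ⟨C₂, hC₂, h₂⟩ := traceControlled_univ hΩ
  -- In units of `A + Y`: `C₁` bounds the function, `1` the gradient, and `C₂ * (C₁ + 1)` the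
  -- boundary values.
  set C := C₁ + 1 + C₂ * (C₁ + 1) with hC
  have hCt : C ≠ ⊤ := by finiteness
  have hC0 : 0 < C.toReal := ENNReal.toReal_pos (by simp [hC]) hCt
  refine ⟨C.toReal / c, by positivity, fun φ hφ1 => ⟨_, rfl, ?_⟩⟩
  have hmφ := memLp_of_continuous hΩ hφ1.continuous
  have hmg := memLp_of_continuous hΩ (continuous_gradient hφ1)
  have hσi := integrable_coeff_inner hσ hmg hmg
  have hqi := integrable_coeff_mul hq hmφ hmφ
  have hσn : 0 ≤ᵐ[volume.restrict Ω] fun x => σ x * inner ℝ (gradient φ x) (gradient φ x) := by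
    filter_upwards [hσc] with x hx
    exact mul_nonneg (hc.le.trans hx) real_inner_self_nonneg
  have hqn : 0 ≤ᵐ[volume.restrict Ω] fun x => q x * (φ x * φ x) := by
    filter_upwards [hq0] with x hx
    exact mul_nonneg hx (mul_self_nonneg _)
  have hσI := integral_nonneg_of_ae hσn
  have hqI := integral_nonneg_of_ae hqn
  have hres : (volume.restrict Ω).restrict D = volume.restrict D :=
    Measure.restrict_restrict_of_subset hDΩ
  set A := ∫⁻ x in Ω, ‖gradient φ x‖ₑ ^ 2
  set Y := ∫⁻ x in D, ‖φ x‖ₑ ^ 2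
  set U := ∫⁻ x in Ω, ‖φ x‖ₑ ^ 2
  have hU : U ≤ C₁ * (A + Y) := by simpa using h₁ φ hφ1
  have hA := mul_setLIntegral_le_ofReal_integral (f := fun x => ‖gradient φ x‖) hc.le
    (s := univ) hσi hσn (by
      rw [Measure.restrict_univ]
      filter_upwards [hσc] with x hx
      rw [real_inner_self_eq_norm_sq]
      gcongr)
  have hY := mul_setLIntegral_le_ofReal_integral (f := φ) hc.le hqi hqn (s := D) (by
    rw [hres]
    filter_upwards [hqc] with x hx
    rw [← sq]
    gcongr)
  rw [hres] at hY
  simp only [Measure.restrict_univ, enorm_norm] at hA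
  have h3 := h₂ φ hφ1
  rw [Measure.restrict_univ] at h3
  have hc0 : ENNReal.ofReal c ≠ 0 := by simpa using hc
  refine ⟨add_nonneg hσI hqI, ?_⟩
  calc _ ≤ C₁ * (A + Y) + (A + Y) + C₂ * (C₁ * (A + Y) + (A + Y)) := by
        refine add_le_add (add_le_add hU le_self_add) (h3.trans ?_)
        gcongr
        exact le_self_add
    _ = C * (ENNReal.ofReal c)⁻¹ * (ENNReal.ofReal c * A + ENNReal.ofReal c * Y) := by
        rw [← mul_add, mul_assoc, ← mul_assoc _ (ENNReal.ofReal c),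
          ENNReal.inv_mul_cancel hc0 (by simp), hC]
        ring
    _ ≤ C * (ENNReal.ofReal c)⁻¹ * (ENNReal.ofReal _ + ENNReal.ofReal _) :=
        mul_le_mul_right (add_le_add hA hY) _
    _ = _ := by
        rw [← ENNReal.ofReal_add hσI hqI, ENNReal.ofReal_mul (by positivity),
          ENNReal.ofReal_div_of_pos hc, ENNReal.ofReal_toReal hCt, div_eq_mul_inv]

section Abstract

variable {V : Type*} [NormedAddCommGroup V] [InnerProductSpace ℝ V]

theorem coercive_topologicalClosure {S : Submodule ℝ V} {B : V →L[ℝ] V →L[ℝ] ℝ} {K : ℝ}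
    (h : ∀ p ∈ S, ‖p‖ ^ 2 ≤ K * B p p) : ∀ p ∈ S.topologicalClosure, ‖p‖ ^ 2 ≤ K * B p p := by
  have hclosed : IsClosed {p : V | ‖p‖ ^ 2 ≤ K * B p p} := isClosed_le (by fun_prop) (by fun_prop)
  exact fun p hp => closure_minimal h hclosed hp

/-- The Lax-Milgram theorem on a closed subspace. -/
theorem exists_mem_topologicalClosure_eq [CompleteSpace V] {S : Submodule ℝ V}
    {B : V →L[ℝ] V →L[ℝ] ℝ} {K : ℝ} (hK : 0 < K) (h : ∀ p ∈ S, ‖p‖ ^ 2 ≤ K * B p p)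
    (ℓ : V →L[ℝ] ℝ) : ∃ v ∈ S.topologicalClosure, ∀ w ∈ S.topologicalClosure, B v w = ℓ w := by
  have hcl := coercive_topologicalClosure h
  set T := S.topologicalClosure with hT
  have : CompleteSpace T := (Submodule.isClosed_topologicalClosure S).completeSpace_coe
  set B' : T →L[ℝ] T →L[ℝ] ℝ := B.bilinearComp T.subtypeL T.subtypeL with hB
  have hcoer : IsCoercive B' := by
    refine ⟨K⁻¹, by positivity, fun p => ?_⟩
    have := hcl p p.2
    rw [mul_assoc, ← sq, inv_mul_le_iff₀ hK]
    exact this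
  set v := hcoer.continuousLinearEquivOfBilin.symm
    ((InnerProductSpace.toDual ℝ _).symm (ℓ.comp T.subtypeL)) with hv
  refine ⟨v, v.2, fun w hw => ?_⟩
  have : B' v ⟨w, hw⟩ = ℓ w := by
    rw [← hcoer.continuousLinearEquivOfBilin_apply, hv, ContinuousLinearEquiv.apply_symm_apply,
      InnerProductSpace.toDual_symm_apply]
    rfl
  exact this

end Abstract

/-- Coercivity of the bilinear form. -/
theorem exists_coercive (hΩ : IsSmoothBoundedDomain Ω) (hDo : IsOpen D) (hDne : D.Nonempty)
    (hDΩ : D ⊆ Ω) {σ q : E n → ℝ} {c : ℝ} (hc : 0 < c) (hσ : MemLp σ ⊤ (volume.restrict Ω))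
    (hq : MemLp q ⊤ (volume.restrict Ω)) (hσc : ∀ᵐ x ∂(volume.restrict Ω), c ≤ σ x)
    (hq0 : ∀ᵐ x ∂(volume.restrict Ω), 0 ≤ q x) (hqc : ∀ᵐ x ∂(volume.restrict D), c ≤ q x) :
    ∃ K : ℝ, 0 < K ∧ ∀ p ∈ smoothTriples Ω, ‖p‖ ^ 2 ≤ K * weakForm hσ.toLp hq.toLp p p := by
  obtain ⟨K, hK, h⟩ := exists_energy_bound hΩ hDo hDne hDΩ hc hσ hq hσc hq0 hqc
  refine ⟨K, hK, ?_⟩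
  rintro p ⟨φ, hφ, k1, k2, k3⟩
  obtain ⟨b, hb, hb0, hle⟩ := h φ (hφ.of_le (by exact_mod_cast le_top))
  have hB : weakForm hσ.toLp hq.toLp p p = b := (weakForm_apply hσ hq k1 k2 k1 k2).trans hb.symm
  rw [← ofReal_norm_sq_eq _ k1, ← ofReal_norm_sq_eq _ k2, ← ofReal_norm_sq_eq _ k3,
    ← ENNReal.ofReal_add (sq_nonneg _) (sq_nonneg _),
    ← ENNReal.ofReal_add (add_nonneg (sq_nonneg _) (sq_nonneg _)) (sq_nonneg _),
    ENNReal.ofReal_le_ofReal_iff (mul_nonneg hK.le hb0)] at hle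
  exact (norm_sq_triple p).trans_le (hle.trans_eq (congrArg (K * ·) hB.symm))

theorem inner_L2Boundary (g f : L2Boundary Ω) :
    inner ℝ g f = ∫ x, g x * f x ∂(surfaceMeasure Ω) := by
  rw [L2.inner_def]
  exact integral_congr_ae (.of_forall fun x => by simp [mul_comm])

/-- Boundary values are a component of the triple, so pairing with `g` is automatically a bounded
functional; every admissible test function is represented in `traceSpace Ω`. -/
theorem exists_isWeakSolution (hΩ : IsSmoothBoundedDomain Ω) (hDo : IsOpen D) (hDne : D.Nonempty)
    (hDΩ : D ⊆ Ω) {σ q : E n → ℝ} {c : ℝ} (hc : 0 < c) (hσ : MemLp σ ⊤ (volume.restrict Ω))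
    (hq : MemLp q ⊤ (volume.restrict Ω)) (hσc : ∀ᵐ x ∂(volume.restrict Ω), c ≤ σ x)
    (hq0 : ∀ᵐ x ∂(volume.restrict Ω), 0 ≤ q x) (hqc : ∀ᵐ x ∂(volume.restrict D), c ≤ q x)
    (g : L2Boundary Ω) : ∃ (u : E n → ℝ) (Du : E n → E n), IsWeakSolution Ω σ q g u Du := by
  obtain ⟨K, hK, h⟩ := exists_coercive hΩ hDo hDne hDΩ hc hσ hq hσc hq0 hqc
  obtain ⟨v, hv, hvw⟩ := exists_mem_topologicalClosure_eq hK h ((realInnerL _ g).comp (WithLp.sndL 2 ℝ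
    (WithLp 2 (Lp ℝ 2 (volume.restrict Ω) × Lp (E n) 2 (volume.restrict Ω))) (L2Boundary Ω)))
  refine ⟨v.fst.fst, v.fst.snd, (hasTrace_of_mem hv).isH1, fun w Dw _ f hf => ?_⟩
  obtain ⟨r, hr, r1, r2, r3⟩ := mem_of_hasTrace hΩ hf
  have key : weakForm hσ.toLp hq.toLp v r = inner ℝ g r.snd := hvw r hr
  rw [r3, inner_L2Boundary] at key
  exact (weakForm_apply hσ hq .rfl .rfl r1 r2).symm.trans key

/-! ### Monotonicity -/

/-- The quadratic form of the Neumann-to-Dirichlet operator is computed by any solution. -/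
theorem inner_NtD_eq {σ q : E n → ℝ} {g f : L2Boundary Ω} {u : E n → ℝ} {Du : E n → E n}
    (h : IsWeakSolution Ω σ q g u Du) (hf : HasTrace Ω u Du f) :
    inner ℝ g (NtD Ω σ q g) = inner ℝ g f := by
  have hex : ∃ f : L2Boundary Ω, ∃ (u : E n → ℝ) (Du : E n → E n),
      IsWeakSolution Ω σ q g u Du ∧ HasTrace Ω u Du f := ⟨f, u, Du, h, hf⟩
  obtain ⟨v, Dv, hv, hvf⟩ := hex.choose_spec
  -- Test each of the two solutions' equations with the other solution; the left sides agree by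
  -- symmetry.
  rw [show NtD Ω σ q g = hex.choose from dif_pos hex, inner_L2Boundary, inner_L2Boundary,
    ← hv.2 u Du h.1 f hf, ← h.2 v Dv hv.1 _ hvf]
  congr 1
  · exact integral_congr_ae (.of_forall fun x => by simp only [real_inner_comm])
  · exact integral_congr_ae (.of_forall fun x => by simp only [mul_comm (u x)])

section Comparison

variable {σ₁ σ₂ q₁ q₂ : E n → ℝ} {g : L2Boundary Ω} {u₁ u₂ : E n → ℝ} {Du₁ Du₂ : E n → E n}

/-- The difference of the Neumann-to-Dirichlet quadratic forms as an integral over `Ω`, in the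
two forms obtained by testing either equation with the solution of the other. -/
theorem inner_NtD_sub_eq (hΩ : IsSmoothBoundedDomain Ω)
    (hσ₁ : MemLp σ₁ ⊤ (volume.restrict Ω)) (hσ₂ : MemLp σ₂ ⊤ (volume.restrict Ω))
    (hq₁ : MemLp q₁ ⊤ (volume.restrict Ω)) (hq₂ : MemLp q₂ ⊤ (volume.restrict Ω))
    (h₁ : IsWeakSolution Ω σ₁ q₁ g u₁ Du₁) (h₂ : IsWeakSolution Ω σ₂ q₂ g u₂ Du₂) :
    ∃ F : E n → ℝ, Integrable F (volume.restrict Ω) ∧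
      (∀ x, F x = σ₁ x * ‖Du₁ x‖ ^ 2 + q₁ x * u₁ x ^ 2
        - 2 * (σ₁ x * inner ℝ (Du₁ x) (Du₂ x) + q₁ x * (u₁ x * u₂ x))
        + (σ₂ x * ‖Du₂ x‖ ^ 2 + q₂ x * u₂ x ^ 2)) ∧
      inner ℝ g (NtD Ω σ₁ q₁ g - NtD Ω σ₂ q₂ g) = ∫ x in Ω, F x := by
  obtain ⟨f₁, hf₁⟩ := h₁.1.exists_hasTrace hΩ
  obtain ⟨f₂, hf₂⟩ := h₂.1.exists_hasTrace hΩ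
  have e₁ := h₁.2 u₁ Du₁ h₁.1 f₁ hf₁
  have e₁₂ := h₁.2 u₂ Du₂ h₂.1 f₂ hf₂
  have e₂ := h₂.2 u₂ Du₂ h₂.1 f₂ hf₂
  have m₁ := h₁.1.1
  have m₂ := h₂.1.1
  have M₁ := h₁.1.2.1
  have M₂ := h₂.1.2.1
  have i₁ := (integrable_coeff_inner hσ₁ M₁ M₁).add (integrable_coeff_mul hq₁ m₁ m₁)
  have i₁₂ := (integrable_coeff_inner hσ₁ M₁ M₂).add (integrable_coeff_mul hq₁ m₁ m₂)
  have i₂ := (integrable_coeff_inner hσ₂ M₂ M₂).add (integrable_coeff_mul hq₂ m₂ m₂)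
  rw [← integral_add (integrable_coeff_inner hσ₁ M₁ M₁) (integrable_coeff_mul hq₁ m₁ m₁),
    ← inner_L2Boundary] at e₁
  rw [← integral_add (integrable_coeff_inner hσ₁ M₁ M₂) (integrable_coeff_mul hq₁ m₁ m₂),
    ← inner_L2Boundary] at e₁₂
  rw [← integral_add (integrable_coeff_inner hσ₂ M₂ M₂) (integrable_coeff_mul hq₂ m₂ m₂),
    ← inner_L2Boundary] at e₂
  refine ⟨_, (i₁.sub (i₁₂.const_mul 2)).add i₂, fun x => ?_, ?_⟩
  · simp only [Pi.add_apply, Pi.sub_apply, real_inner_self_eq_norm_sq, sq (u₁ x), sq (u₂ x)]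
  · rw [inner_sub_right, inner_NtD_eq h₁ hf₁, inner_NtD_eq h₂ hf₂]
    -- Here `a = b₁(u₁,u₁)`, `b = b₁(u₁,u₂)`, `c = b₂(u₂,u₂)`, and the last two coincide.
    have : ∀ a b c : ℝ, a = inner ℝ g f₁ → b = inner ℝ g f₂ → c = inner ℝ g f₂ →
        inner ℝ g f₁ - inner ℝ g f₂ = a - 2 * b + c := by
      rintro _ _ _ rfl rfl rfl; ring
    rw [this _ _ _ e₁ e₁₂ e₂]
    refine ((integral_add (i₁.sub (i₁₂.const_mul 2)) i₂).trans ?_).symm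
    congr 1
    refine (integral_sub i₁ (i₁₂.const_mul 2)).trans ?_
    rw [integral_const_mul]
    rfl

theorem integrable_energy {σ q : E n → ℝ} {u : E n → ℝ} {Du : E n → E n}
    (hσ : MemLp σ ⊤ (volume.restrict Ω)) (hq : MemLp q ⊤ (volume.restrict Ω))
    (hu : MemLp u 2 (volume.restrict Ω)) (hDu : MemLp Du 2 (volume.restrict Ω)) :
    Integrable (fun x => σ x * ‖Du x‖ ^ 2 + q x * u x ^ 2) (volume.restrict Ω) := by
  refine ((integrable_coeff_inner hσ hDu hDu).add (integrable_coeff_mul hq hu hu)).congr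
    (.of_forall fun x => ?_)
  simp only [Pi.add_apply, real_inner_self_eq_norm_sq, sq (u x)]

/-- `F` exceeds the integrand by `σ₁ ‖Du₁ - Du₂‖² + q₁ (u₁ - u₂)²`. -/
theorem integral_energy_le_inner_NtD_sub (hΩ : IsSmoothBoundedDomain Ω)
    (hσ₁ : MemLp σ₁ ⊤ (volume.restrict Ω)) (hσ₂ : MemLp σ₂ ⊤ (volume.restrict Ω))
    (hq₁ : MemLp q₁ ⊤ (volume.restrict Ω)) (hq₂ : MemLp q₂ ⊤ (volume.restrict Ω))
    (hσ₁0 : ∀ᵐ x ∂(volume.restrict Ω), 0 ≤ σ₁ x) (hq₁0 : ∀ᵐ x ∂(volume.restrict Ω), 0 ≤ q₁ x)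
    (h₁ : IsWeakSolution Ω σ₁ q₁ g u₁ Du₁) (h₂ : IsWeakSolution Ω σ₂ q₂ g u₂ Du₂) :
    ∫ x in Ω, ((σ₂ x - σ₁ x) * ‖Du₂ x‖ ^ 2 + (q₂ x - q₁ x) * u₂ x ^ 2)
      ≤ inner ℝ g (NtD Ω σ₁ q₁ g - NtD Ω σ₂ q₂ g) := by
  obtain ⟨F, hFi, hF, hFe⟩ := inner_NtD_sub_eq hΩ hσ₁ hσ₂ hq₁ hq₂ h₁ h₂
  rw [hFe]
  refine integral_mono_ae (integrable_energy (hσ₂.sub hσ₁) (hq₂.sub hq₁) h₂.1.1 h₂.1.2.1) hFi ?_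
  filter_upwards [hσ₁0, hq₁0] with x hs hq
  rw [hF]
  have k1 : 0 ≤ σ₁ x * ‖Du₁ x - Du₂ x‖ ^ 2 := by positivity
  have k2 : 0 ≤ q₁ x * (u₁ x - u₂ x) ^ 2 := by positivity
  rw [norm_sub_sq_real] at k1
  linarith

theorem inner_NtD_sub_le_integral_energy (hΩ : IsSmoothBoundedDomain Ω)
    (hσ₁ : MemLp σ₁ ⊤ (volume.restrict Ω)) (hσ₂ : MemLp σ₂ ⊤ (volume.restrict Ω))
    (hq₁ : MemLp q₁ ⊤ (volume.restrict Ω)) (hq₂ : MemLp q₂ ⊤ (volume.restrict Ω))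
    (hσ₂0 : ∀ᵐ x ∂(volume.restrict Ω), 0 ≤ σ₂ x) (hq₂0 : ∀ᵐ x ∂(volume.restrict Ω), 0 ≤ q₂ x)
    (h₁ : IsWeakSolution Ω σ₁ q₁ g u₁ Du₁) (h₂ : IsWeakSolution Ω σ₂ q₂ g u₂ Du₂) :
    inner ℝ g (NtD Ω σ₁ q₁ g - NtD Ω σ₂ q₂ g)
      ≤ ∫ x in Ω, ((σ₂ x - σ₁ x) * ‖Du₁ x‖ ^ 2 + (q₂ x - q₁ x) * u₁ x ^ 2) := by
  have h := integral_energy_le_inner_NtD_sub hΩ hσ₂ hσ₁ hq₂ hq₁ hσ₂0 hq₂0 h₂ h₁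
  rw [← neg_sub (NtD Ω σ₁ q₁ g), inner_neg_right, le_neg, ← integral_neg] at h
  refine h.trans_eq (integral_congr_ae (.of_forall fun x => ?_))
  simp only
  ring

/-- `F` exceeds the integrand by `σ₂ ‖(σ₁/σ₂) Du₁ - Du₂‖²` and the analogous square in `u`. The
alternative `q₁ = q₂ = 0` covers points without absorption, where division by zero returns `0`. -/
theorem integral_energy_quotient_le_inner_NtD_sub (hΩ : IsSmoothBoundedDomain Ω)
    (hσ₁ : MemLp σ₁ ⊤ (volume.restrict Ω)) (hσ₂ : MemLp σ₂ ⊤ (volume.restrict Ω))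
    (hq₁ : MemLp q₁ ⊤ (volume.restrict Ω)) (hq₂ : MemLp q₂ ⊤ (volume.restrict Ω))
    (hσ : MemLp (fun x => σ₁ x ^ 2 / σ₂ x) ⊤ (volume.restrict Ω))
    (hq : MemLp (fun x => q₁ x ^ 2 / q₂ x) ⊤ (volume.restrict Ω))
    (hσ₂0 : ∀ᵐ x ∂(volume.restrict Ω), 0 < σ₂ x)
    (hq₂0 : ∀ᵐ x ∂(volume.restrict Ω), 0 < q₂ x ∨ q₁ x = 0 ∧ q₂ x = 0)
    (h₁ : IsWeakSolution Ω σ₁ q₁ g u₁ Du₁) (h₂ : IsWeakSolution Ω σ₂ q₂ g u₂ Du₂) :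
    ∫ x in Ω, ((σ₁ x - σ₁ x ^ 2 / σ₂ x) * ‖Du₁ x‖ ^ 2 + (q₁ x - q₁ x ^ 2 / q₂ x) * u₁ x ^ 2)
      ≤ inner ℝ g (NtD Ω σ₁ q₁ g - NtD Ω σ₂ q₂ g) := by
  obtain ⟨F, hFi, hF, hFe⟩ := inner_NtD_sub_eq hΩ hσ₁ hσ₂ hq₁ hq₂ h₁ h₂
  rw [hFe]
  refine integral_mono_ae (integrable_energy (hσ₁.sub hσ) (hq₁.sub hq) h₁.1.1 h₁.1.2.1) hFi ?_
  filter_upwards [hσ₂0, hq₂0] with x hs hq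
  rw [hF]
  have k1 : 0 ≤ σ₁ x ^ 2 / σ₂ x * ‖Du₁ x‖ ^ 2 - 2 * (σ₁ x * inner ℝ (Du₁ x) (Du₂ x))
      + σ₂ x * ‖Du₂ x‖ ^ 2 := by
    have e : σ₁ x ^ 2 / σ₂ x * ‖Du₁ x‖ ^ 2 - 2 * (σ₁ x * inner ℝ (Du₁ x) (Du₂ x))
        + σ₂ x * ‖Du₂ x‖ ^ 2 = σ₂ x * ‖(σ₁ x / σ₂ x) • Du₁ x - Du₂ x‖ ^ 2 := by
      rw [norm_sub_sq_real, norm_smul, real_inner_smul_left, Real.norm_eq_abs, mul_pow, sq_abs]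
      field_simp
    rw [e]
    positivity
  have k2 : 0 ≤ q₁ x ^ 2 / q₂ x * u₁ x ^ 2 - 2 * (q₁ x * (u₁ x * u₂ x)) + q₂ x * u₂ x ^ 2 := by
    rcases hq with hq | ⟨hq, hq'⟩
    · have e : q₁ x ^ 2 / q₂ x * u₁ x ^ 2 - 2 * (q₁ x * (u₁ x * u₂ x)) + q₂ x * u₂ x ^ 2
          = q₂ x * (q₁ x / q₂ x * u₁ x - u₂ x) ^ 2 := by
        field_simp
        ring
      rw [e]
      positivity
    · simp [hq, hq']
  linarith

end Comparison

/-! ### Admissible coefficients -/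

theorem LinftyPlus.ae_pos {f : E n → ℝ} (h : LinftyPlus S f) :
    ∀ᵐ x ∂(volume.restrict S), 0 < f x := by
  obtain ⟨-, c, hc, h⟩ := h
  filter_upwards [h] with x hx using hc.trans_le hx

theorem LinftyPlus.memLp_sq_div {f h : E n → ℝ} (hf : MemLp f ⊤ (volume.restrict S))
    (hh : LinftyPlus S h) : MemLp (fun x => f x ^ 2 / h x) ⊤ (volume.restrict S) := by
  obtain ⟨hm, c, hc, hch⟩ := hh
  refine memLp_top_of_bound
    ((hf.1.aemeasurable.pow_const 2).div hm.1.aemeasurable).aestronglyMeasurable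
    ((eLpNormEssSup f (volume.restrict S)).toReal ^ 2 / c) ?_
  have hfin : eLpNormEssSup f (volume.restrict S) ≠ ⊤ := by simpa using hf.2.ne
  filter_upwards [hch, ae_le_eLpNormEssSup (f := f) (μ := volume.restrict S)] with x hx hfx
  have hfx' : ‖f x‖ ≤ (eLpNormEssSup f (volume.restrict S)).toReal := by
    simpa using ENNReal.toReal_mono hfin hfx
  rw [norm_div, norm_pow]
  gcongr
  exact hx.trans (le_abs_self _)

theorem LinftyPlus.twoPhase {s₀ s₁ : ℝ} (h₀ : 0 < s₀) (h₁ : 0 < s₁) (hΩ : IsOpen Ω)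
    (hD : IsOpen D) : LinftyPlus Ω (twoPhase Ω D s₀ s₁) := by
  have hval : ∀ x ∈ Ω, NeumannProblem.twoPhase Ω D s₀ s₁ x = s₀ ∨
      NeumannProblem.twoPhase Ω D s₀ s₁ x = s₁ := fun x hx => by
    by_cases hxD : x ∈ D <;> simp [NeumannProblem.twoPhase, hx, hxD]
  refine ⟨memLp_top_of_bound (Measurable.aestronglyMeasurable ?_) (max s₀ s₁) ?_,
    min s₀ s₁, lt_min h₀ h₁, ?_⟩
  · exact (measurable_const.indicator (hΩ.measurableSet.diff hD.measurableSet)).add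
      (measurable_const.indicator hD.measurableSet)
  · filter_upwards [ae_restrict_mem hΩ.measurableSet] with x hx
    rcases hval x hx with h | h <;> rw [h, Real.norm_of_nonneg (by positivity)] <;> simp
  · filter_upwards [ae_restrict_mem hΩ.measurableSet] with x hx
    rcases hval x hx with h | h <;> rw [h] <;> simp

theorem memLp_indicator (hD : IsOpen D) (hDΩ : D ⊆ Ω) {q : E n → ℝ}
    (hq : MemLp q ⊤ (volume.restrict D)) : MemLp (D.indicator q) ⊤ (volume.restrict Ω) := by
  rwa [memLp_indicator_iff_restrict hD.measurableSet, Measure.restrict_restrict_of_subset hDΩ]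

theorem ae_indicator (hD : IsOpen D) {q : E n → ℝ} (hq : LinftyPlus D q) :
    ∀ᵐ x ∂(volume.restrict Ω), x ∈ D → 0 < q x :=
  ae_restrict_of_ae ((ae_restrict_iff' hD.measurableSet).1 hq.ae_pos)

theorem LinftyPlus.exists_isWeakSolution_indicator (hΩ : IsSmoothBoundedDomain Ω)
    (hD : IsOpen D) (hDne : D.Nonempty) (hDΩ : D ⊆ Ω) {σ q : E n → ℝ} (hσ : LinftyPlus Ω σ)
    (hq : LinftyPlus D q) (g : L2Boundary Ω) :
    ∃ (u : E n → ℝ) (Du : E n → E n), IsWeakSolution Ω σ (D.indicator q) g u Du := by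
  have hpos := ae_indicator (Ω := Ω) hD hq
  obtain ⟨hσm, a, ha, hσa⟩ := hσ
  obtain ⟨hqm, b, hb, hqb⟩ := hq
  refine exists_isWeakSolution hΩ hD hDne hDΩ (lt_min ha hb) hσm (memLp_indicator hD hDΩ hqm)
    ?_ ?_ ?_ g
  · filter_upwards [hσa] with x hx using (min_le_left _ _).trans hx
  · filter_upwards [hpos] with x hx
    by_cases hxD : x ∈ D
    · simpa [hxD] using (hx hxD).le
    · simp [hxD]
  · filter_upwards [hqb, ae_restrict_mem hD.measurableSet] with x hx hxD
    simpa [hxD] using Or.inr hx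

/-- Comparison of two absorption coefficients supported in `D`. -/
theorem LinftyPlus.inner_NtDAbs_sub (hΩ : IsSmoothBoundedDomain Ω)
    (hD : IsOpen D) (hDne : D.Nonempty) (hDΩ : D ⊆ Ω) {s₀ s₁ : ℝ} (h₀ : 0 < s₀) (h₁ : 0 < s₁)
    {q₁ q₂ : E n → ℝ} (hq₁ : LinftyPlus D q₁) (hq₂ : LinftyPlus D q₂) {g : L2Boundary Ω}
    {u₂ : E n → ℝ} {Du₂ : E n → E n}
    (hu₂ : IsWeakSolution Ω (NeumannProblem.twoPhase Ω D s₀ s₁) (D.indicator q₂) g u₂ Du₂) :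
    inner ℝ g (NtDAbs Ω D s₀ s₁ q₂ g - NtDAbs Ω D s₀ s₁ q₁ g)
        ≤ ∫ x in D, (q₁ x - q₂ x) * u₂ x ^ 2 ∧
    ∫ x in D, (q₂ x - q₂ x ^ 2 / q₁ x) * u₂ x ^ 2
        ≤ inner ℝ g (NtDAbs Ω D s₀ s₁ q₂ g - NtDAbs Ω D s₀ s₁ q₁ g) := by
  have hσ := LinftyPlus.twoPhase h₀ h₁ hΩ.isOpen hD
  -- Only `u₂` is given, and the comparison needs a solution for `q₁` as well.
  obtain ⟨u₁, Du₁, hu₁⟩ := hσ.exists_isWeakSolution_indicator hΩ hD hDne hDΩ hq₁ g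
  have hm₁ := memLp_indicator hD hDΩ hq₁.1
  have hm₂ := memLp_indicator hD hDΩ hq₂.1
  have hp₁ := ae_indicator (Ω := Ω) hD hq₁
  have hset : ∀ F : E n → ℝ, ∫ x in D, F x = ∫ x in Ω, D.indicator F x := fun F => by
    rw [integral_indicator hD.measurableSet, Measure.restrict_restrict_of_subset hDΩ]
  have hdiv : (fun x => D.indicator q₂ x ^ 2 / D.indicator q₁ x)
      = D.indicator fun x => q₂ x ^ 2 / q₁ x := by
    ext x
    by_cases hx : x ∈ D <;> simp [hx]
  constructor
  · refine (inner_NtD_sub_le_integral_energy hΩ hσ.1 hσ.1 hm₂ hm₁ ?_ ?_ hu₂ hu₁).trans_eq ?_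
    · filter_upwards [hσ.ae_pos] with x hx using hx.le
    · filter_upwards [hp₁] with x hx
      by_cases hxD : x ∈ D
      · simpa [hxD] using (hx hxD).le
      · simp [hxD]
    · rw [hset]
      refine integral_congr_ae (.of_forall fun x => ?_)
      by_cases hx : x ∈ D <;> simp [hx]
  · refine le_trans (le_of_eq ?_) (integral_energy_quotient_le_inner_NtD_sub hΩ hσ.1 hσ.1 hm₂ hm₁
      (LinftyPlus.memLp_sq_div hσ.1 hσ) ?_ hσ.ae_pos ?_ hu₂ hu₁)
    · rw [hset]
      refine integral_congr_ae ?_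
      filter_upwards [hσ.ae_pos] with x hσx
      -- Both problems share the diffusion coefficient, so the gradient term drops out.
      have hσ' : NeumannProblem.twoPhase Ω D s₀ s₁ x
          - NeumannProblem.twoPhase Ω D s₀ s₁ x ^ 2 / NeumannProblem.twoPhase Ω D s₀ s₁ x = 0 := by
        rw [sq, mul_div_assoc, div_self hσx.ne', mul_one, sub_self]
      by_cases hx : x ∈ D <;> simp [hx, hσ']
    · rw [hdiv]
      exact memLp_indicator hD hDΩ (LinftyPlus.memLp_sq_div hq₂.1 hq₁)
    · filter_upwards [hp₁] with x hx
      by_cases hxD : x ∈ D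
      · exact Or.inl (by simpa [hxD] using hx hxD)
      · exact Or.inr (by simp [hxD])

end NeumannProblem

theorem lemma3p4 {n : ℕ} (hn : 1 ≤ n) {Ω : Set (E n)}
    (hΩ : IsSmoothBoundedDomain Ω) :
    -- diffusion and absorption coefficients on `Ω`
    (∀ σ₁ σ₂ q₁ q₂ : E n → ℝ,
      LinftyPlus Ω σ₁ → LinftyPlus Ω σ₂ →
      LinftyPlus Ω q₁ → LinftyPlus Ω q₂ →
      ∀ (g : L2Boundary Ω) (u₁ u₂ : E n → ℝ)
        (Du₁ Du₂ : E n → E n),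
        IsWeakSolution Ω σ₁ q₁ g u₁ Du₁ →
        IsWeakSolution Ω σ₂ q₂ g u₂ Du₂ →
        inner ℝ g (NtD Ω σ₁ q₁ g - NtD Ω σ₂ q₂ g)
            ≤ ∫ x in Ω, ((σ₂ x - σ₁ x) * ‖Du₁ x‖ ^ 2 + (q₂ x - q₁ x) * u₁ x ^ 2) ∧
        ∫ x in Ω, ((σ₂ x - σ₁ x) * ‖Du₂ x‖ ^ 2 + (q₂ x - q₁ x) * u₂ x ^ 2)
            ≤ inner ℝ g (NtD Ω σ₁ q₁ g - NtD Ω σ₂ q₂ g) ∧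
        ∫ x in Ω, ((σ₁ x - σ₁ x ^ 2 / σ₂ x) * ‖Du₁ x‖ ^ 2 + (q₁ x - q₁ x ^ 2 / q₂ x) * u₁ x ^ 2)
            ≤ inner ℝ g (NtD Ω σ₁ q₁ g - NtD Ω σ₂ q₂ g) ∧
        ∫ x in Ω, ((σ₁ x - σ₁ x ^ 2 / σ₂ x) * ‖Du₁ x‖ ^ 2 + (q₁ x - q₁ x ^ 2 / q₂ x) * u₁ x ^ 2)
            = ∫ x in Ω, (σ₁ x / σ₂ x * (σ₂ x - σ₁ x) * ‖Du₁ x‖ ^ 2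
                + q₁ x / q₂ x * (q₂ x - q₁ x) * u₁ x ^ 2)) ∧
    -- known two-phase diffusion coefficient, absorption coefficients on `D`
    (∀ D : Set (E n), IsOpen D → D.Nonempty → closure D ⊆ Ω →
      ∀ s₀ s₁ : ℝ, 0 < s₀ → 0 < s₁ →
      ∀ q₁ q₂ : E n → ℝ,
        LinftyPlus D q₁ → LinftyPlus D q₂ →
        (∀ (g : L2Boundary Ω) (u₂ : E n → ℝ)
          (Du₂ : E n → E n),
          IsWeakSolution Ω (twoPhase Ω D s₀ s₁) (D.indicator q₂)
            g u₂ Du₂ →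
          inner ℝ g (NtDAbs Ω D s₀ s₁ q₂ g - NtDAbs Ω D s₀ s₁ q₁ g)
              ≤ ∫ x in D, (q₁ x - q₂ x) * u₂ x ^ 2 ∧
          ∫ x in D, (q₂ x - q₂ x ^ 2 / q₁ x) * u₂ x ^ 2
              ≤ inner ℝ g (NtDAbs Ω D s₀ s₁ q₂ g
                  - NtDAbs Ω D s₀ s₁ q₁ g)) ∧
        ((∀ᵐ x ∂(volume.restrict D), q₁ x ≤ q₂ x) →
          ∀ g : L2Boundary Ω,
            inner ℝ g (NtDAbs Ω D s₀ s₁ q₂ g)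
              ≤ inner ℝ g (NtDAbs Ω D s₀ s₁ q₁ g))) := by
  refine ⟨fun σ₁ σ₂ q₁ q₂ hσ₁ hσ₂ hq₁ hq₂ g u₁ u₂ Du₁ Du₂ h₁ h₂ => ⟨?_, ?_, ?_, ?_⟩,
    fun D hD hDne hDΩ s₀ s₁ h₀ h₁ q₁ q₂ hq₁ hq₂ =>
      ⟨fun g u₂ Du₂ hu₂ => ?_, fun hle g => ?_⟩⟩
  · exact inner_NtD_sub_le_integral_energy hΩ hσ₁.1 hσ₂.1 hq₁.1 hq₂.1
      (hσ₂.ae_pos.mono fun _ => le_of_lt) (hq₂.ae_pos.mono fun _ => le_of_lt) h₁ h₂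
  · exact integral_energy_le_inner_NtD_sub hΩ hσ₁.1 hσ₂.1 hq₁.1 hq₂.1
      (hσ₁.ae_pos.mono fun _ => le_of_lt) (hq₁.ae_pos.mono fun _ => le_of_lt) h₁ h₂
  · exact integral_energy_quotient_le_inner_NtD_sub hΩ hσ₁.1 hσ₂.1 hq₁.1 hq₂.1
      (hσ₂.memLp_sq_div hσ₁.1) (hq₂.memLp_sq_div hq₁.1) hσ₂.ae_pos
      (hq₂.ae_pos.mono fun _ => Or.inl) h₁ h₂
  · refine integral_congr_ae ?_
    filter_upwards [hσ₂.ae_pos, hq₂.ae_pos] with x hs hq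
    field_simp
  · exact LinftyPlus.inner_NtDAbs_sub hΩ hD hDne (subset_closure.trans hDΩ) h₀ h₁ hq₁ hq₂ hu₂
  · have hDΩ' : D ⊆ Ω := subset_closure.trans hDΩ
    -- No solution is given here; with one constructed, the upper bound has a nonpositive integrand.
    obtain ⟨u₂, Du₂, hu₂⟩ := (LinftyPlus.twoPhase h₀ h₁ hΩ.isOpen hD).exists_isWeakSolution_indicator
      hΩ hD hDne hDΩ' hq₂ g
    have h := (LinftyPlus.inner_NtDAbs_sub hΩ hD hDne hDΩ' h₀ h₁ hq₁ hq₂ hu₂).1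
    rw [inner_sub_right] at h
    have hneg : ∫ x in D, (q₁ x - q₂ x) * u₂ x ^ 2 ≤ 0 := by
      refine integral_nonpos_of_ae ?_
      filter_upwards [hle] with x hx
      exact mul_nonpos_of_nonpos_of_nonneg (sub_nonpos.2 hx) (sq_nonneg _)
    linarith
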